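/- Let $X$ be a finite-dimensional real Hilbert space, $T>0$, and let $F:[0,T]\times X\to\mathbb{R}$ satisfy: (F0) $F\in C^1([0,T]\times X)$; (F1) for every $\rho>0$ the set $\{u\in X:\ \sup_{t\in[0,T]}|F(t,u)|\le\rho\}$ is bounded; (F2) there are $C_1,C_2>0$ with $|\partial_tF(t,u)|\le C_1(F(t,u)+C_2)$ for all $(t,u)\in[0,T]\times X$; (F3) for every $t\in[0,T]$ the set $\mathcal C(t)=\{u\in X:\nabla_xF(t,u)=0\}$ consists of isolated points; (F4) for every $t\in[0,T]$ and $u\in\mathcal C(t)$, $\ \liminf_{v\to u}\frac{F(t,v)-F(t,u)}{\|\nabla_xF(t,v)\|}\ge0$; (F5) $t\mapsto\nabla_xF(t,u)$ is Lipschitz continuous on $[0,T]$, locally uniformly with respect to $u\in X$. Let $u^0\in X$, $\lambda\in(0,\infty)$, and let $\varepsilon_j,\tau_j>0$ be such that $\varepsilon_j\to0$, $\tau_j\to0$ and $\varepsilon_j/\tau_j\to\lambda$. For each $j$ put $m_j=\lfloor T/\tau_j\rfloor$, let $u_j^0=u^0$, and let $u_j^1,\dots,u_j^{m_j}$ satisfy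 $$u_j^k\in\operatorname{argmin}_{x\in X}\Big\{F(k\tau_j,x)+\frac{\varepsilon_j}{2\tau_j}\|x-u_j^{k-1}\|^2\Big\},\qquad k=1,\dots,m_j .$$ Let $\tilde u_j:[0,T]\to X$ be the piecewise constant interpolant: $\tilde u_j(0)=u^0$, $\tilde u_j(t)=u_j^k$ for $t\in((k-1)\tau_j,k\tau_j]$, $1\le k\le m_j$, and $\tilde u_j(t)=u_j^{m_j}$ for $t\in(m_j\tau_j,T]$. For $t\in[0,T]$ and $u,v\in X$ define the residual stability function and the transition cost by $$\mathcal R_\lambda(t,u)=F(t,u)-\min_{v\in X}\Big\{F(t,v)+\frac\lambda2\|v-u\|^2\Big\},$$ $$c^\lambda(t,u,v)=\inf\Big\{\sum_{i=0}^{N-1}\frac\lambda2\|w^i-w^{i+1}\|^2+\sum_{i=0}^{N}\mathcal R_\lambda(t,w^i):\ N\ge1,\ w^0,\dots,w^N\in X,\ w^0=u,\ w^N=v\Big\}.$$ Call $x\in X$ $\lambda$-stable at time $t$ if $F(t,x)\le F(t,v)+\frac\lambda2\|v-x\|^2$ for all $v\in X$. For a function $u$ with one-sided limits denote by $u_\pm(t)$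 its right and left limits, with the conventions $u_-(0)=u(0)$ and $u_+(T)=u_-(T)$, and let $J=\{r\in[0,T]:u_-(r)\ne u_+(r)\}$. Then there are a subsequence (not relabelled) and a function $u:[0,T]\to X$ such that $\tilde u_j(t)\to u(t)$ for every $t\in[0,T]$, and: (i) $u$ is regulated, i.e. it has a left limit at every point of $(0,T]$ and a right limit at every point of $[0,T)$; (ii) (stability) $u_+(t)$ is $\lambda$-stable at time $t$ for every $t\in[0,T]$, and $u_-(t)$ is $\lambda$-stable at time $t$ for every $t\in(0,T]$; (iii) (energy balance) for all $0\le s\le t\le T$ the function $r\mapsto\partial_rF(r,u(r))$ is integrable on $[s,t]$, the sum below converges, and $$F(t,u_+(t))+\sum_{r\in J\cap[s,t]}c^\lambda(r,u_+(r),u_-(r))=F(s,u_-(s))+\int_s^t\partial_rF(r,u(r))\,dr .$$ Moreover, if $u(T)$ is $\lambda$-stable at time $T$, then (iii) with $t=T$ and $0\le s\le T$ also holds when $u_+(T)$ is taken to be $u(T)$ instead of $u_-(T)$ (both in the energy term and in the definition of $J$). -/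

import Mathlib

open Set Filter Topology

noncomputable section

namespace MinMov

variable {X : Type*} [NormedAddCommGroup X] [InnerProductSpace ℝ X] [CompleteSpace X]

/-- The partial derivative `∂ₜ F(t,u)` on the closed time interval `[0,T]`
(one-sided at the two end points). -/
def timeDeriv (T : ℝ) (F : ℝ → X → ℝ) (t : ℝ) (u : X) : ℝ :=
  derivWithin (fun s => F s u) (Icc 0 T) t

/-- The set `C(t)` of critical points of `F(t,·)`, where `∇ₓ F(t,u) = 0`. -/
def criticalSet (F : ℝ → X → ℝ) (t : ℝ) : Set X :=
  {u | gradient (F t) u = 0}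

/-- The standing assumptions (F0)-(F5) on an energy `F : [0,T] × X → ℝ`
(values of `F` at times outside `[0,T]` play no role). -/
structure EnergyAssumptions (T : ℝ) (F : ℝ → X → ℝ) : Prop where
  /-- `F` is of class `C¹` on `[0,T] × X`. -/
  F0 : ContDiffOn ℝ 1 (fun p : ℝ × X => F p.1 p.2) (Icc 0 T ×ˢ univ)
  /-- The sublevels of `u ↦ sup_{t ∈ [0,T]} |F(t,u)|` are bounded. -/
  F1 : ∀ ρ : ℝ, 0 < ρ → Bornology.IsBounded {u : X | (⨆ t : Icc (0 : ℝ) T, |F t u|) ≤ ρ}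
  /-- Control of the power by the energy. -/
  F2 : ∃ C₁ C₂ : ℝ, 0 < C₁ ∧ 0 < C₂ ∧
    ∀ t ∈ Icc (0 : ℝ) T, ∀ u : X, |timeDeriv T F t u| ≤ C₁ * (F t u + C₂)
  /-- The critical points at each time are isolated. -/
  F3 : ∀ t ∈ Icc (0 : ℝ) T, ∀ u ∈ criticalSet F t,
    ∃ r : ℝ, 0 < r ∧ ∀ v ∈ criticalSet F t, dist v u < r → v = u
  /-- `liminf_{v → u} (F(t,v) - F(t,u)) / ‖∇ₓ F(t,v)‖ ≥ 0` at critical points `u`; the lower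
  limit is taken in the extended reals. -/
  F4 : ∀ t ∈ Icc (0 : ℝ) T, ∀ u ∈ criticalSet F t,
    0 ≤ liminf (fun v => (((F t v - F t u) / ‖gradient (F t) v‖ : ℝ) : EReal)) (𝓝[≠] u)
  /-- `t ↦ ∇ₓ F(t,u)` is Lipschitz continuous on `[0,T]`, locally uniformly in `u`. -/
  F5 : ∀ u : X, ∃ L : NNReal, ∃ V ∈ 𝓝 u, ∀ v ∈ V,
    LipschitzOnWith L (fun t => gradient (F t) v) (Icc 0 T)

/-- `U 0, …, U m`, with `m = ⌊T/τ⌋`, solves the incremental scheme with initial point `u₀`: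
`U k` minimizes `x ↦ F(kτ,x) + ε/(2τ) ‖x - U (k-1)‖²` over `X` for `k = 1, …, m`. -/
def IsDiscreteSolution (T : ℝ) (F : ℝ → X → ℝ) (u₀ : X) (ε τ : ℝ) (U : ℕ → X) : Prop :=
  U 0 = u₀ ∧ ∀ k : ℕ, 1 ≤ k → k ≤ ⌊T / τ⌋₊ →
    IsMinOn (fun x => F (k * τ) x + ε / (2 * τ) * ‖x - U (k - 1)‖ ^ 2) univ (U k)

/-- The left-continuous piecewise constant interpolant: it equals `U 0` at time `0`, `U k` on
`((k-1)τ, kτ]` for `1 ≤ k ≤ m = ⌊T/τ⌋`, and `U m` on the remaining piece `(mτ, T]`. -/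
def interpolant (T τ : ℝ) (U : ℕ → X) (t : ℝ) : X :=
  U (min ⌈t / τ⌉₊ ⌊T / τ⌋₊)

/-- The stability condition `F(t,u) ≤ F(t,v) + (lam/2) ‖v - u‖²` for all `v`. -/
def IsStable (F : ℝ → X → ℝ) (lam t : ℝ) (u : X) : Prop :=
  ∀ v : X, F t u ≤ F t v + lam / 2 * ‖v - u‖ ^ 2

/-- The residual stability function `R_lam(t,u) = F(t,u) - min_v {F(t,v) + (lam/2) ‖v - u‖²}`. -/
def residual (F : ℝ → X → ℝ) (lam t : ℝ) (u : X) : ℝ :=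
  F t u - ⨅ v : X, (F t v + lam / 2 * ‖v - u‖ ^ 2)

/-- The cost of the chain `w 0, …, w N`. -/
def chainCost (F : ℝ → X → ℝ) (lam t : ℝ) (N : ℕ) (w : ℕ → X) : ℝ :=
  ∑ i ∈ Finset.range N, lam / 2 * ‖w i - w (i + 1)‖ ^ 2
    + ∑ i ∈ Finset.range (N + 1), residual F lam t (w i)

/-- The transition cost `c^lam(t,u,v)`: the infimum of the costs of all finite chains
from `u` to `v`. -/
def transitionCost (F : ℝ → X → ℝ) (lam t : ℝ) (u v : X) : ℝ :=
  sInf {S : ℝ | ∃ (N : ℕ) (w : ℕ → X), 1 ≤ N ∧ w 0 = u ∧ w N = v ∧ S = chainCost F lam t N w}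

/-- `u : [0,T] → X` is regulated, with left limits `uₗ` and right limits `uᵣ`. At the two end
points, where one of the limits does not make sense, the conventions are `uₗ(0) = u(0)` and
`uᵣ(T) = uₗ(T)`. -/
structure IsRegulatedWith (T : ℝ) (u uₗ uᵣ : ℝ → X) : Prop where
  left : ∀ t ∈ Ioc (0 : ℝ) T, Tendsto u (𝓝[<] t) (𝓝 (uₗ t))
  right : ∀ t ∈ Ico (0 : ℝ) T, Tendsto u (𝓝[>] t) (𝓝 (uᵣ t))
  left_zero : uₗ 0 = u 0
  right_end : uᵣ T = uₗ T

/-- The jump set of a regulated function in terms of its left and right limits. -/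
def jumpSet (T : ℝ) (uₗ uᵣ : ℝ → X) : Set ℝ :=
  {r | r ∈ Icc 0 T ∧ uₗ r ≠ uᵣ r}

/-- The energy balance on `[s,t]`:
`F(t,u₊(t)) + ∑_{r ∈ J ∩ [s,t]} c^lam(r,u₊(r),u₋(r)) = F(s,u₋(s)) + ∫_s^t ∂ᵣF(r,u(r)) dr`,
with a convergent sum and an integrable power. -/
def EnergyBalance (T : ℝ) (F : ℝ → X → ℝ) (lam : ℝ) (u uₗ uᵣ : ℝ → X) (s t : ℝ) : Prop :=
  IntervalIntegrable (fun r => timeDeriv T F r (u r)) MeasureTheory.volume s t ∧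
  ∃ D : ℝ,
    HasSum (fun r : ↥(jumpSet T uₗ uᵣ ∩ Icc s t) => transitionCost F lam r (uᵣ r) (uₗ r)) D ∧
    F t (uᵣ t) + D = F s (uₗ s) + ∫ r in s..t, timeDeriv T F r (u r)

end MinMov

end

/-! Everything is driven by the energy drop of each step, measured at the new time. The sum of the
drops, `cumCost`, is increasing in the step index and bounded, and by `cumCost_eq` it equals initial
energy minus current energy plus the work of ∂ₜF. Minimality bounds each drop below by the squared
displacement plus the residual at the starting point (`le_stepCost`).

Compactness: stable points are critical, so by (F3) a bounded set contains finitely many at each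
time, and away from them the residual is bounded below. A trajectory with little cost in a short
time is thus trapped near one stable point (`exists_oscillation`). Helly's theorem for the costs
then yields pointwise convergence of the interpolants to some u and of the costs to a monotone W,
and the same oscillation bound makes u regulated. At continuity times of W an iterate and its
predecessor have the same limit, so minimality becomes stability; one-sided limits inherit it by
closedness.

Energy balance: in the limit W(t) = F(0,u₀) - F(t,u(t)) + ∫₀ᵗ ∂ᵣF, and two facts remain. First,
across a jump the transition cost equals the energy gap. It is at least the gap by telescoping
(`sub_le_transitionCost`); it is at most the gap because the discrete trajectory is almost an
admissible chain once loops near stable points are erased, which keeps the errors of unboundedly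
many steps from accumulating (`stepChain_of_balls`, `exists_transitionCost_le`). Second, nothing is
dissipated outside jumps: (F4) and (F5) give the reduced energy a nonnegative lower right Dini
derivative (`eventually_reducedEnergy_ge`), so its decrease is the sum of its gaps (`hasSum_gap`).
-/

set_option linter.unusedSectionVars false

namespace MinMov

variable {X : Type*} [NormedAddCommGroup X] [InnerProductSpace ℝ X] [CompleteSpace X]
variable {T : ℝ} {F : ℝ → X → ℝ}

/-! ### Regularity and growth of the energy. -/

namespace EnergyAssumptions

theorem continuousOn (hF : EnergyAssumptions T F) :
    ContinuousOn (fun p : ℝ × X => F p.1 p.2) (Icc 0 T ×ˢ univ) :=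
  hF.F0.continuousOn

theorem continuousOn_time (hF : EnergyAssumptions T F) (u : X) :
    ContinuousOn (fun t => F t u) (Icc 0 T) :=
  hF.continuousOn.comp (f := fun t => (t, u)) (by fun_prop) fun _ ht => ⟨ht, mem_univ _⟩

theorem differentiable (hF : EnergyAssumptions T F) {t : ℝ} (ht : t ∈ Icc 0 T) :
    Differentiable ℝ (F t) := by
  have h := hF.F0.differentiableOn one_ne_zero
  rw [← differentiableOn_univ]
  exact h.comp (f := fun u : X => (t, u))
    (DifferentiableOn.prodMk (differentiableOn_const _) differentiableOn_id)
    fun _ _ => ⟨ht, mem_univ _⟩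

theorem continuous (hF : EnergyAssumptions T F) {t : ℝ} (ht : t ∈ Icc 0 T) :
    Continuous (F t) :=
  (hF.differentiable ht).continuous

theorem hasDerivWithinAt_aux (hF : EnergyAssumptions T F) {t : ℝ} (ht : t ∈ Icc 0 T) (u : X) :
    HasDerivWithinAt (fun s => F s u)
      (fderivWithin ℝ (fun p : ℝ × X => F p.1 p.2) (Icc 0 T ×ˢ univ) (t, u) (1, 0))
      (Icc 0 T) t := by
  have h := (hF.F0.differentiableOn one_ne_zero (t, u) ⟨ht, mem_univ _⟩).hasFDerivWithinAt
  have h2 : HasDerivWithinAt (fun s : ℝ => (s, u)) ((1 : ℝ), (0 : X)) (Icc 0 T) t :=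
    (hasDerivWithinAt_id t _).prodMk (hasDerivWithinAt_const t _ u)
  have hm : MapsTo (fun s : ℝ => (s, u)) (Icc 0 T) (Icc 0 T ×ˢ univ) :=
    fun s hs => ⟨hs, mem_univ _⟩
  exact h.comp_hasDerivWithinAt t h2 hm

theorem timeDeriv_eq (hF : EnergyAssumptions T F) (hT : 0 < T) {t : ℝ} (ht : t ∈ Icc 0 T)
    (u : X) : timeDeriv T F t u =
      fderivWithin ℝ (fun p : ℝ × X => F p.1 p.2) (Icc 0 T ×ˢ univ) (t, u) (1, 0) :=
  (hF.hasDerivWithinAt_aux ht u).derivWithin (uniqueDiffOn_Icc hT t ht)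

theorem hasDerivWithinAt (hF : EnergyAssumptions T F) (hT : 0 < T) {t : ℝ} (ht : t ∈ Icc 0 T)
    (u : X) : HasDerivWithinAt (fun s => F s u) (timeDeriv T F t u) (Icc 0 T) t := by
  rw [hF.timeDeriv_eq hT ht]
  exact hF.hasDerivWithinAt_aux ht u

theorem hasDerivAt (hF : EnergyAssumptions T F) (hT : 0 < T) {t : ℝ} (ht : t ∈ Ioo 0 T)
    (u : X) : HasDerivAt (fun s => F s u) (timeDeriv T F t u) t :=
  (hF.hasDerivWithinAt hT (Ioo_subset_Icc_self ht) u).hasDerivAt (Icc_mem_nhds ht.1 ht.2)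

theorem continuousOn_timeDeriv (hF : EnergyAssumptions T F) (hT : 0 < T) :
    ContinuousOn (fun p : ℝ × X => timeDeriv T F p.1 p.2) (Icc 0 T ×ˢ univ) := by
  have h := hF.F0.continuousOn_fderivWithin ((uniqueDiffOn_Icc hT).prod uniqueDiffOn_univ)
    le_rfl
  refine (h.clm_apply (continuousOn_const (c := ((1 : ℝ), (0 : X))))).congr ?_
  rintro ⟨t, u⟩ ⟨ht, -⟩
  exact hF.timeDeriv_eq hT ht u

theorem intervalIntegrable_timeDeriv (hF : EnergyAssumptions T F) (hT : 0 < T) {a b : ℝ}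
    (ha : a ∈ Icc 0 T) (hb : b ∈ Icc 0 T) (u : X) :
    IntervalIntegrable (fun r => timeDeriv T F r u) MeasureTheory.volume a b := by
  refine ContinuousOn.intervalIntegrable ?_
  exact (hF.continuousOn_timeDeriv hT).comp (f := fun r => (r, u)) (by fun_prop)
    fun r hr => ⟨uIcc_subset_Icc ha hb hr, mem_univ _⟩

theorem integral_timeDeriv (hF : EnergyAssumptions T F) (hT : 0 < T) {a b : ℝ}
    (ha : a ∈ Icc 0 T) (hb : b ∈ Icc 0 T) (hab : a ≤ b) (u : X) :
    ∫ r in a..b, timeDeriv T F r u = F b u - F a u := by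
  refine intervalIntegral.integral_eq_sub_of_hasDeriv_right_of_le (f := fun s => F s u) hab
    ((hF.continuousOn_time u).mono (Icc_subset_Icc ha.1 hb.2)) (fun x hx => ?_)
    (hF.intervalIntegrable_timeDeriv hT ha hb u)
  exact (hF.hasDerivAt hT ⟨ha.1.trans_lt hx.1, hx.2.trans_le hb.2⟩ u).hasDerivWithinAt

/-- The energy is bounded below, and it varies in time at most exponentially. -/
theorem exists_growth (hF : EnergyAssumptions T F) (hT : 0 < T) :
    ∃ C₁ C₂ : ℝ, 0 < C₁ ∧ 0 < C₂ ∧ (∀ t ∈ Icc 0 T, ∀ u, 0 ≤ F t u + C₂) ∧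
      (∀ a ∈ Icc 0 T, ∀ b ∈ Icc 0 T, a ≤ b → ∀ u,
        F b u + C₂ ≤ Real.exp (C₁ * (b - a)) * (F a u + C₂)) ∧
      (∀ a ∈ Icc 0 T, ∀ b ∈ Icc 0 T, a ≤ b → ∀ u,
        F a u + C₂ ≤ Real.exp (C₁ * (b - a)) * (F b u + C₂)) := by
  obtain ⟨C₁, C₂, h1, h2, h⟩ := hF.F2
  refine ⟨C₁, C₂, h1, h2, fun t ht u => ?_, fun a ha b hb hab u => ?_, fun a ha b hb hab u => ?_⟩
  · exact nonneg_of_mul_nonneg_right ((abs_nonneg _).trans (h t ht u)) h1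
  -- Gronwall: by (F2) the weight exp(-C₁t) makes F + C₂ decreasing, and exp(C₁t) below makes it
  -- increasing.
  · have hd : ∀ x ∈ Ioo a b, HasDerivAt (fun t => Real.exp (-C₁ * t) * (F t u + C₂))
        (Real.exp (-C₁ * x) * (-C₁) * (F x u + C₂) +
          Real.exp (-C₁ * x) * timeDeriv T F x u) x := by
      intro x hx
      have e : HasDerivAt (fun t => Real.exp (-C₁ * t)) (Real.exp (-C₁ * x) * (-C₁)) x := by
        simpa using ((hasDerivAt_id x).const_mul (-C₁)).exp
      exact e.mul ((hF.hasDerivAt hT ⟨ha.1.trans_lt hx.1, hx.2.trans_le hb.2⟩ u).add_const C₂)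
    have anti : AntitoneOn (fun t => Real.exp (-C₁ * t) * (F t u + C₂)) (Icc a b) := by
      refine antitoneOn_of_deriv_nonpos (convex_Icc a b) ?_ ?_ ?_
      · exact ContinuousOn.mul (by fun_prop) (((hF.continuousOn_time u).mono
          (Icc_subset_Icc ha.1 hb.2)).add continuousOn_const)
      · rw [interior_Icc]
        exact fun x hx => (hd x hx).differentiableAt.differentiableWithinAt
      · rw [interior_Icc]
        intro x hx
        rw [(hd x hx).deriv]
        have := (le_abs_self _).trans (h x ⟨ha.1.trans hx.1.le, hx.2.le.trans hb.2⟩ u)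
        have := Real.exp_pos (-C₁ * x)
        nlinarith
    have h3 := anti (left_mem_Icc.2 hab) (right_mem_Icc.2 hab) hab
    have h4 : Real.exp (C₁ * (b - a)) = Real.exp (C₁ * b) * Real.exp (-C₁ * a) := by
      rw [← Real.exp_add]; ring_nf
    have h5 : Real.exp (C₁ * b) * Real.exp (-C₁ * b) = 1 := by
      rw [← Real.exp_add]; simp
    have h6 := mul_le_mul_of_nonneg_left h3 (Real.exp_pos (C₁ * b)).le
    simp only [← mul_assoc, h5, one_mul] at h6
    rw [h4]; exact h6
  · have hd : ∀ x ∈ Ioo a b, HasDerivAt (fun t => Real.exp (C₁ * t) * (F t u + C₂))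
        (Real.exp (C₁ * x) * C₁ * (F x u + C₂) +
          Real.exp (C₁ * x) * timeDeriv T F x u) x := by
      intro x hx
      have e : HasDerivAt (fun t => Real.exp (C₁ * t)) (Real.exp (C₁ * x) * C₁) x := by
        simpa using ((hasDerivAt_id x).const_mul C₁).exp
      exact e.mul ((hF.hasDerivAt hT ⟨ha.1.trans_lt hx.1, hx.2.trans_le hb.2⟩ u).add_const C₂)
    have mono : MonotoneOn (fun t => Real.exp (C₁ * t) * (F t u + C₂)) (Icc a b) := by
      refine monotoneOn_of_deriv_nonneg (convex_Icc a b) ?_ ?_ ?_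
      · exact ContinuousOn.mul (by fun_prop) (((hF.continuousOn_time u).mono
          (Icc_subset_Icc ha.1 hb.2)).add continuousOn_const)
      · rw [interior_Icc]
        exact fun x hx => (hd x hx).differentiableAt.differentiableWithinAt
      · rw [interior_Icc]
        intro x hx
        rw [(hd x hx).deriv]
        have := (neg_abs_le (timeDeriv T F x u))
        have := (h x ⟨ha.1.trans hx.1.le, hx.2.le.trans hb.2⟩ u)
        have := Real.exp_pos (C₁ * x)
        nlinarith
    have h3 := mono (left_mem_Icc.2 hab) (right_mem_Icc.2 hab) hab
    have h4 : Real.exp (C₁ * (b - a)) = Real.exp (-C₁ * a) * Real.exp (C₁ * b) := by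
      rw [← Real.exp_add]; ring_nf
    have h5 : Real.exp (-C₁ * a) * Real.exp (C₁ * a) = 1 := by
      rw [← Real.exp_add]; simp
    have h6 := mul_le_mul_of_nonneg_left h3 (Real.exp_pos (-C₁ * a)).le
    simp only [← mul_assoc, h5, one_mul] at h6
    rw [h4]; exact h6

theorem exists_lower_bound (hF : EnergyAssumptions T F) (hT : 0 < T) :
    ∃ C : ℝ, ∀ t ∈ Icc 0 T, ∀ u, -C ≤ F t u := by
  obtain ⟨-, C, -, -, h, -⟩ := hF.exists_growth hT
  exact ⟨C, fun t ht u => by linarith [h t ht u]⟩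

/-- Sublevels of the energy are bounded uniformly in time. -/
theorem exists_norm_le (hF : EnergyAssumptions T F) (hT : 0 < T) (c : ℝ) :
    ∃ R : ℝ, 0 < R ∧ ∀ t ∈ Icc 0 T, ∀ u, F t u ≤ c → ‖u‖ ≤ R := by
  obtain ⟨C₁, C₂, h1, h2, h3, h4, h5⟩ := hF.exists_growth hT
  -- (F1) needs a bound at all times; M is what the growth estimate yields from the bound c at a
  -- single time.
  set M := Real.exp (C₁ * T) * (|c| + C₂) + C₂ with hM
  have hMpos : 0 < M := by positivity
  obtain ⟨R, hR⟩ := (hF.F1 M hMpos).exists_norm_le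
  refine ⟨max R 1, by positivity, fun t ht u hu => (hR u ?_).trans (le_max_left _ _)⟩
  have : Nonempty (Icc (0 : ℝ) T) := ⟨⟨t, ht⟩⟩
  change (⨆ t : Icc (0 : ℝ) T, |F t u|) ≤ M
  refine ciSup_le fun s => ?_
  have key : F s u + C₂ ≤ Real.exp (C₁ * T) * (F t u + C₂) := by
    rcases le_total t (s : ℝ) with hst | hst
    · refine (h4 t ht s s.2 hst u).trans (mul_le_mul_of_nonneg_right ?_ (h3 t ht u))
      exact Real.exp_le_exp.2 (mul_le_mul_of_nonneg_left (by linarith [ht.1, s.2.2]) h1.le)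
    · refine (h5 s s.2 t ht hst u).trans (mul_le_mul_of_nonneg_right ?_ (h3 t ht u))
      exact Real.exp_le_exp.2 (mul_le_mul_of_nonneg_left (by linarith [ht.2, s.2.1]) h1.le)
  have key2 : Real.exp (C₁ * T) * (F t u + C₂) ≤ Real.exp (C₁ * T) * (|c| + C₂) :=
    mul_le_mul_of_nonneg_left (by linarith [le_abs_self c]) (Real.exp_pos _).le
  have := h3 s s.2 u
  have : 0 ≤ Real.exp (C₁ * T) * (|c| + C₂) := by positivity
  rw [abs_le]
  constructor <;> linarith

end EnergyAssumptions

/-! ### Residual stability function and stable points. -/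

section Residual

variable {lam t : ℝ}

theorem bddBelow_range_penalized (hF : EnergyAssumptions T F) (hT : 0 < T) (hlam : 0 < lam)
    (ht : t ∈ Icc 0 T) (u : X) :
    BddBelow (range fun v : X => F t v + lam / 2 * ‖v - u‖ ^ 2) := by
  obtain ⟨C, hC⟩ := hF.exists_lower_bound hT
  refine ⟨-C, ?_⟩
  rintro _ ⟨v, rfl⟩
  have := hC t ht v
  have : 0 ≤ lam / 2 * ‖v - u‖ ^ 2 := by positivity
  dsimp only
  linarith

theorem sub_le_residual (hF : EnergyAssumptions T F) (hT : 0 < T) (hlam : 0 < lam)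
    (ht : t ∈ Icc 0 T) (u v : X) :
    F t u - F t v - lam / 2 * ‖v - u‖ ^ 2 ≤ residual F lam t u := by
  have := ciInf_le (bddBelow_range_penalized hF hT hlam ht u) v
  unfold residual
  linarith

theorem residual_nonneg (hF : EnergyAssumptions T F) (hT : 0 < T) (hlam : 0 < lam)
    (ht : t ∈ Icc 0 T) (u : X) : 0 ≤ residual F lam t u := by
  simpa using sub_le_residual hF hT hlam ht u u

/-- Almost minimizers suffice throughout, so attainment of the infimum is never needed. -/
theorem exists_residual_le {θ : ℝ} (hθ : 0 < θ) (u : X) :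
    ∃ v, residual F lam t u ≤ F t u - F t v - lam / 2 * ‖v - u‖ ^ 2 + θ := by
  obtain ⟨v, hv⟩ := exists_lt_of_ciInf_lt
    (lt_add_of_pos_right (⨅ v : X, (F t v + lam / 2 * ‖v - u‖ ^ 2)) hθ)
  refine ⟨v, ?_⟩
  unfold residual
  linarith

theorem IsStable.residual_eq_zero (hF : EnergyAssumptions T F) (hT : 0 < T) (hlam : 0 < lam)
    (ht : t ∈ Icc 0 T) {u : X} (hu : IsStable F lam t u) : residual F lam t u = 0 := by
  refine le_antisymm ?_ (residual_nonneg hF hT hlam ht u)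
  have := le_ciInf hu
  unfold residual
  linarith

/-- Stable points are critical. -/
theorem IsStable.mem_criticalSet (hF : EnergyAssumptions T F)
    (ht : t ∈ Icc 0 T) {u : X} (hu : IsStable F lam t u) : u ∈ criticalSet F t := by
  have hmin : IsLocalMin (fun v => F t v + lam / 2 * ‖v - u‖ ^ 2) u :=
    Eventually.of_forall fun v => by simpa using hu v
  have hd : HasFDerivAt (fun v => F t v + lam / 2 * ‖v - u‖ ^ 2)
      (fderiv ℝ (F t) u + (lam / 2) • (2 • (innerSL ℝ (u - u)))) u := by
    have h1 : HasFDerivAt (fun v : X => ‖v - u‖ ^ 2) (2 • (innerSL ℝ (u - u))) u := by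
      simpa using (HasFDerivAt.norm_sq ((hasFDerivAt_id u).sub_const u))
    exact (hF.differentiable ht u).hasFDerivAt.add (h1.const_mul _)
  have h0 := hmin.hasFDerivAt_eq_zero hd
  simp only [sub_self, map_zero, smul_zero, add_zero] at h0
  simp [criticalSet, gradient, h0]

/-- Stability is closed under joint limits in time and space. -/
theorem isStable_of_tendsto (hF : EnergyAssumptions T F) {ι : Type*} {l : Filter ι} [l.NeBot]
    {s σ : ι → ℝ} {x y : ι → X} {u : X} (hs : ∀ᶠ i in l, s i ∈ Icc 0 T) (ht : t ∈ Icc 0 T)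
    (hst : Tendsto s l (𝓝 t)) (hσ : Tendsto σ l (𝓝 lam))
    (hx : Tendsto x l (𝓝 u)) (hy : Tendsto y l (𝓝 u))
    (h : ∀ᶠ i in l, ∀ v, F (s i) (x i) ≤ F (s i) v + σ i / 2 * ‖v - y i‖ ^ 2) :
    IsStable F lam t u := by
  intro v
  have hc : ∀ (z : ι → X) (w : X), Tendsto z l (𝓝 w) →
      Tendsto (fun i => F (s i) (z i)) l (𝓝 (F t w)) := by
    intro z w hz
    refine (hF.continuousOn (t, w) ⟨ht, mem_univ _⟩).tendsto.comp
      (tendsto_nhdsWithin_iff.2 ⟨hst.prodMk_nhds hz, ?_⟩)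
    filter_upwards [hs] with i hi using ⟨hi, mem_univ _⟩
  refine le_of_tendsto_of_tendsto (hc x u hx)
    ((hc _ v tendsto_const_nhds).add ((hσ.div_const 2).mul
      (((tendsto_const_nhds (x := v)).sub hy).norm.pow 2))) ?_
  filter_upwards [h] with i hi using hi v

end Residual

/-! ### Helly selection with a companion sequence. -/

section Selection

/-- Tychonoff in place of a diagonal argument: a countable product of first countable spaces is
first countable, so its compact subsets are sequentially compact. -/
theorem exists_subseq_tendsto_of_countable {Y : Type*} [TopologicalSpace Y]
    [FirstCountableTopology Y] {K : Set Y} (hK : IsCompact K) (f : ℕ → ℝ → Y)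
    (hf : ∀ j t, f j t ∈ K) {S : Set ℝ} (hS : S.Countable) :
    ∃ φ : ℕ → ℕ, StrictMono φ ∧ ∀ s ∈ S, ∃ y, Tendsto (fun j => f (φ j) s) atTop (𝓝 y) := by
  have : Countable S := hS.to_subtype
  have hc : IsCompact (univ.pi fun _ : S => K) := isCompact_univ_pi fun _ => hK
  obtain ⟨y, -, φ, hφ, h⟩ := hc.isSeqCompact (x := fun j (s : S) => f j s)
    fun j s _ => hf j s
  exact ⟨φ, hφ, fun s hs => ⟨y ⟨s, hs⟩, tendsto_pi_nhds.1 h ⟨s, hs⟩⟩⟩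

theorem exists_rat_sandwich {f : ℝ → ℝ} {t c δ : ℝ} (hf : ContinuousAt f t)
    (hc : 0 < c) (hδ : 0 < δ) :
    ∃ q q' : ℚ, (q : ℝ) < t ∧ t < q' ∧ t - q < δ ∧ q' - t < δ ∧
      |f q - f t| < c ∧ |f q' - f t| < c := by
  obtain ⟨d, hd, h⟩ := Metric.continuousAt_iff.1 hf c hc
  obtain ⟨q, hq1, hq2⟩ := exists_rat_btwn (show t - min d δ < t by
    linarith [lt_min hd hδ])
  obtain ⟨q', hq1', hq2'⟩ := exists_rat_btwn (show t < t + min d δ by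
    linarith [lt_min hd hδ])
  have := min_le_left d δ
  have := min_le_right d δ
  refine ⟨q, q', hq2, hq1', by linarith, by linarith, ?_, ?_⟩
  · exact h (by rw [Real.dist_eq, abs_lt]; constructor <;> linarith)
  · exact h (by rw [Real.dist_eq, abs_lt]; constructor <;> linarith)

/-- Helly's selection principle for monotone functions, together with pointwise compactness of a
companion sequence of maps whose oscillation is controlled by these functions. -/
theorem exists_subseq_tendsto_of_oscillation {Y : Type*} [PseudoMetricSpace Y] [CompleteSpace Y]
    {K : Set Y} (hK : IsCompact K) (v : ℕ → ℝ → Y) (V : ℕ → ℝ → ℝ) {C : ℝ}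
    (hv : ∀ j t, v j t ∈ K) (hV : ∀ j, Monotone (V j)) (hVC : ∀ j t, V j t ∈ Icc 0 C)
    (hosc : ∀ η > 0, ∃ c > 0, ∃ δ > 0, ∀ᶠ j in atTop, ∀ s t, s ≤ t → t - s ≤ δ →
      V j t - V j s < c → dist (v j s) (v j t) < η) :
    ∃ φ : ℕ → ℕ, StrictMono φ ∧ ∃ (u : ℝ → Y) (W : ℝ → ℝ), Monotone W ∧
      (∀ t, Tendsto (fun j => V (φ j) t) atTop (𝓝 (W t))) ∧
      ∀ t, Tendsto (fun j => v (φ j) t) atTop (𝓝 (u t)) := by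
  obtain ⟨φ, hφ, hφ'⟩ := exists_subseq_tendsto_of_countable isCompact_Icc V hVC
    (countable_range ((↑) : ℚ → ℝ))
  -- The limsup is a monotone extension of the limit on the rationals; at its continuity points,
  -- rationals on both sides force convergence.
  set f : ℝ → ℝ := fun t => limsup (fun j => V (φ j) t) atTop with hf
  have hbd : ∀ t, IsBoundedUnder (· ≤ ·) atTop fun j => V (φ j) t := fun t =>
    isBoundedUnder_of ⟨C, fun j => (hVC _ t).2⟩
  have hbd' : ∀ t, IsBoundedUnder (· ≥ ·) atTop fun j => V (φ j) t := fun t =>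
    isBoundedUnder_of ⟨0, fun j => (hVC _ t).1⟩
  have hfm : Monotone f := fun s t hst =>
    limsup_le_limsup (Eventually.of_forall fun j => hV _ hst) (hbd' s).isCoboundedUnder_le (hbd t)
  have hfq : ∀ q : ℚ, Tendsto (fun j => V (φ j) q) atTop (𝓝 (f q)) := by
    intro q
    obtain ⟨y, hy⟩ := hφ' q ⟨q, rfl⟩
    rwa [show f q = y from hy.limsup_eq]
  have hfc : ∀ t, ContinuousAt f t → Tendsto (fun j => V (φ j) t) atTop (𝓝 (f t)) := by
    intro t ht
    rw [Metric.tendsto_nhds]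
    intro e he
    obtain ⟨q, q', h1, h2, -, -, h5, h6⟩ := exists_rat_sandwich ht he one_pos
    rw [abs_lt] at h5 h6
    filter_upwards [(hfq q).eventually (lt_mem_nhds (show f t - e < f q by linarith)),
      (hfq q').eventually (gt_mem_nhds (show f q' < f t + e by linarith))] with j h7 h8
    have := hV (φ j) h1.le
    have := hV (φ j) h2.le
    rw [Real.dist_eq, abs_lt]
    constructor <;> linarith
  -- Second extraction: convergence of both sequences on the rationals and on the countable set
  -- where `f` is discontinuous.
  obtain ⟨ψ, hψ, hψ'⟩ := exists_subseq_tendsto_of_countable (isCompact_Icc.prod hK)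
    (fun j t => (V (φ j) t, v (φ j) t)) (fun j t => ⟨hVC _ t, hv _ t⟩)
    ((countable_range ((↑) : ℚ → ℝ)).union hfm.countable_not_continuousAt)
  have hVlim : ∀ t, ∃ y, Tendsto (fun j => V (φ (ψ j)) t) atTop (𝓝 y) := by
    intro t
    by_cases ht : ContinuousAt f t
    · exact ⟨_, (hfc t ht).comp hψ.tendsto_atTop⟩
    · obtain ⟨y, hy⟩ := hψ' t (Or.inr ht)
      exact ⟨y.1, (continuous_fst.tendsto y).comp hy⟩
  have hvlim : ∀ t, ∃ y, Tendsto (fun j => v (φ (ψ j)) t) atTop (𝓝 y) := by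
    intro t
    by_cases ht : ContinuousAt f t
    -- At a continuity point, `v` at t stays close to `v` at a rational q just before t, since the
    -- increment of `V` up to q' > t is small; and `v` converges at q.
    · refine cauchySeq_tendsto_of_complete (Metric.cauchySeq_iff'.2 fun e he => ?_)
      obtain ⟨c, hc, δ, hδ, h⟩ := hosc (e / 4) (by positivity)
      obtain ⟨q, q', h1, h2, h3, -, h5, h6⟩ := exists_rat_sandwich ht (half_pos hc) hδ
      obtain ⟨y, hy⟩ := hψ' q (Or.inl ⟨q, rfl⟩)
      have hy2 := (continuous_snd.tendsto y).comp hy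
      have hy3 := hy2.eventually (Metric.ball_mem_nhds y.2 (show 0 < e / 4 by positivity))
      have h7 := (hφ.comp hψ).tendsto_atTop.eventually h
      have h8 := (((hfq q').sub (hfq q)).comp hψ.tendsto_atTop).eventually
        (gt_mem_nhds (show f q' - f q < c by rw [abs_lt] at h5 h6; linarith))
      have h9 : ∀ᶠ j in atTop, dist (v (φ (ψ j)) t) y.2 < e / 2 := by
        filter_upwards [hy3, h7, h8] with j h10 h11 h12
        have h13 := h11 q t h1.le h3.le (by
          have := hV (φ (ψ j)) h2.le
          simp only [Function.comp] at h12 ⊢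
          linarith)
        simp only [Function.comp] at h10 h13
        have := dist_triangle_left (v (φ (ψ j)) t) y.2 (v (φ (ψ j)) q)
        linarith
      obtain ⟨N, hN⟩ := eventually_atTop.1 h9
      refine ⟨N, fun n hn => ?_⟩
      have := dist_triangle_right (v (φ (ψ n)) t) (v (φ (ψ N)) t) y.2
      linarith [hN n hn, hN N le_rfl]
    · obtain ⟨y, hy⟩ := hψ' t (Or.inr ht)
      exact ⟨y.2, (continuous_snd.tendsto y).comp hy⟩
  choose W hW using hVlim
  choose u hu using hvlim
  exact ⟨φ ∘ ψ, hφ.comp hψ, u, W,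
    fun s t hst => le_of_tendsto_of_tendsto' (hW s) (hW t) fun j => hV _ hst, hW, hu⟩

variable {Y : Type*} [PseudoMetricSpace Y] [CompleteSpace Y] {u : ℝ → Y} {W : ℝ → ℝ}

/-- Convergence of `W` along `l` makes its increments small near `t`, so the image filter of `u` is
Cauchy. Applied to one-sided neighbourhoods, it makes the limit regulated. -/
theorem exists_tendsto_of_oscillation {l : Filter ℝ} [l.NeBot] {t w : ℝ}
    (hosc : ∀ η > 0, ∃ c > 0, ∃ δ > 0, ∀ s t, s ≤ t → t - s ≤ δ →
      W t - W s < c → dist (u s) (u t) ≤ η)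
    (hl : l ≤ 𝓝 t) (hW : Tendsto W l (𝓝 w)) : ∃ y, Tendsto u l (𝓝 y) := by
  refine CompleteSpace.complete (f := map u l) (Metric.cauchy_iff.2 ⟨inferInstance, fun e he => ?_⟩)
  obtain ⟨c, hc, δ, hδ, h⟩ := hosc (e / 2) (half_pos he)
  refine ⟨u '' {s | dist s t < δ / 2 ∧ dist (W s) w < c / 2}, image_mem_map ?_, ?_⟩
  · filter_upwards [hl (Metric.ball_mem_nhds t (half_pos hδ)),
      hW.eventually (Metric.ball_mem_nhds w (half_pos hc))] with s h1 h2 using ⟨h1, h2⟩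
  · have key : ∀ a b, a ≤ b → dist a t < δ / 2 ∧ dist (W a) w < c / 2 →
        dist b t < δ / 2 ∧ dist (W b) w < c / 2 → dist (u a) (u b) < e := by
      intro a b hab ha hb
      simp only [Real.dist_eq, abs_lt] at ha hb
      refine (h a b hab ?_ ?_).trans_lt (half_lt_self he) <;> linarith [ha.1.1, ha.2.1, hb.1.2, hb.2.2]
    rintro _ ⟨a, ha, rfl⟩ _ ⟨b, hb, rfl⟩
    rcases le_total a b with hab | hab
    · exact key a b hab ha hb
    · rw [dist_comm]; exact key b a hab hb ha

end Selection

/-! ### A decreasing function without continuous part is the sum of its gaps. -/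

section JumpSum

/-- If the gap `Em - Ep ≥ 0` is the only loss of the decreasing one-sided limits `Em`, `Ep`, in the
sense that `Ep` has nonnegative lower right Dini derivatives, then the gaps sum up to the total
variation. -/
theorem hasSum_gap {Em Ep : ℝ → ℝ} {s t : ℝ} (hst : s ≤ t)
    (hgap : ∀ x ∈ Icc s t, Ep x ≤ Em x)
    (hmono : ∀ x ∈ Icc s t, ∀ y ∈ Icc s t, x < y → Em y ≤ Ep x)
    (hleft : ∀ x ∈ Ioc s t, ∀ e > 0, ∀ᶠ y in 𝓝[<] x, Ep y < Em x + e)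
    (hright : ∀ x ∈ Ico s t, ∀ e > 0, ∀ᶠ y in 𝓝[>] x, Ep x - e * (y - x) ≤ Ep y) :
    HasSum ((Icc s t).indicator fun r => Em r - Ep r) (Em s - Ep t) := by
  set J : ℝ → ℝ → ℝ := fun x => (Icc s x).indicator fun r => Em r - Ep r with hJ
  have hJ0 : ∀ x ∈ Icc s t, ∀ r, 0 ≤ J x r := fun x hx r =>
    indicator_nonneg (fun r hr => sub_nonneg.2 (hgap r ⟨hr.1, hr.2.trans hx.2⟩)) r
  -- Gaps at different times are disjoint by `hmono`; removing the largest time gives the induction.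
  have hfin : ∀ A : Finset ℝ, (∀ r ∈ A, r ∈ Icc s t) → ∀ x ∈ Icc s t, (∀ r ∈ A, r < x) →
      ∑ r ∈ A, (Em r - Ep r) ≤ Em s - Em x := by
    intro A
    induction A using Finset.induction_on_max with
    | empty =>
      intro _ x hx _
      rcases hx.1.eq_or_lt with h | h
      · simp [h]
      · have := hmono s (left_mem_Icc.2 hst) x hx h
        have := hgap s (left_mem_Icc.2 hst)
        simp only [Finset.sum_empty]
        linarith
    | insert a A ha ih =>
      intro hA x hx hax
      have haI := hA a (Finset.mem_insert_self _ _)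
      have h1 := ih (fun r hr => hA r (Finset.mem_insert_of_mem hr)) a haI ha
      rw [Finset.sum_insert (fun h => lt_irrefl _ (ha a h))]
      have := hmono a haI x hx (hax a (Finset.mem_insert_self _ _))
      linarith
  have htI : t ∈ Icc s t := right_mem_Icc.2 hst
  have hsI : s ∈ Icc s t := left_mem_Icc.2 hst
  have hfin2 : ∀ A : Finset ℝ, ∑ r ∈ A, J t r ≤ Em s - Ep t := by
    intro A
    classical
    have h1 : ∑ r ∈ A, J t r = ∑ r ∈ A.filter (· ∈ Icc s t), (Em r - Ep r) := by
      rw [Finset.sum_filter]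
      refine Finset.sum_congr rfl fun r _ => ?_
      simp [hJ, indicator_apply]
    -- The time `t` is inserted and split off: its gap leads from `Em t` to `Ep t`, while `hfin`
    -- controls the times before it.
    have h2 : ∑ r ∈ A.filter (· ∈ Icc s t), (Em r - Ep r) ≤
        ∑ r ∈ insert t ((A.filter (· ∈ Icc s t)).erase t), (Em r - Ep r) := by
      refine Finset.sum_le_sum_of_subset_of_nonneg ?_ fun r hr _ => ?_
      · intro r hr
        by_cases h : r = t <;> simp_all
      · rcases Finset.mem_insert.1 hr with rfl | hr
        · exact sub_nonneg.2 (hgap _ htI)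
        · exact sub_nonneg.2 (hgap _ (Finset.mem_filter.1 (Finset.mem_of_mem_erase hr)).2)
    rw [Finset.sum_insert (Finset.notMem_erase _ _)] at h2
    have h3 := hfin ((A.filter (· ∈ Icc s t)).erase t)
      (fun r hr => (Finset.mem_filter.1 (Finset.mem_of_mem_erase hr)).2) t htI (fun r hr =>
        lt_of_le_of_ne (Finset.mem_filter.1 (Finset.mem_of_mem_erase hr)).2.2
          (Finset.ne_of_mem_erase hr))
    linarith
  have hsumt : Summable (J t) := summable_of_sum_le (hJ0 t htI) hfin2
  have hJle : ∀ x ∈ Icc s t, ∀ y ∈ Icc s t, x ≤ y → ∀ r, J x r ≤ J y r := by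
    intro x hx y hy hxy r
    by_cases hr : r ∈ Icc s x
    · have hr' : r ∈ Icc s y := ⟨hr.1, hr.2.trans hxy⟩
      simp [hJ, hr, hr']
    · simpa [hJ, hr] using hJ0 y hy r
  have hsum : ∀ x ∈ Icc s t, Summable (J x) := fun x hx =>
    hsumt.of_nonneg_of_le (hJ0 x hx) (hJle x hx t htI hx.2)
  have hS : ∀ x ∈ Icc s t, ∀ y ∈ Icc s t, x ≤ y → ∑' r, J x r ≤ ∑' r, J y r :=
    fun x hx y hy hxy => (hsum x hx).tsum_le_tsum (hJle x hx y hy hxy) (hsum y hy)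
  have hSjump : ∀ x ∈ Icc s t, ∀ y ∈ Icc s t, y < x →
      ∑' r, J y r + (Em x - Ep x) ≤ ∑' r, J x r := by
    intro x hx y hy hyx
    have h1 : HasSum (fun r => if r = x then Em x - Ep x else 0) (Em x - Ep x) :=
      hasSum_ite_eq x _
    refine hasSum_le (fun r => ?_) ((hsum y hy).hasSum.add h1) (hsum x hx).hasSum
    by_cases hr : r = x
    · subst hr
      have h2 : r ∉ Icc s y := fun h => absurd h.2 (not_le.2 hyx)
      have h3 : r ∈ Icc s r := ⟨hx.1, le_rfl⟩
      simp [hJ, h2, h3]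
    · simpa [hr] using hJle y hy x hx hyx.le r
  have hSs : Em s - Ep s ≤ ∑' r, J s r := by
    simp [hJ]
  -- Continuous induction with slack e(x - s): `hleft` and the gap at the supremum `z` carry the
  -- bound to `z`, and `hright` carries it beyond `z` unless z = t.
  have main : ∀ e > 0, ∀ x ∈ Icc s t, Em s - Ep x ≤ ∑' r, J x r + e * (x - s) := by
    intro e he
    set A : Set ℝ := {x | x ∈ Icc s t ∧ ∀ y ∈ Icc s x, Em s - Ep y ≤ ∑' r, J y r + e * (y - s)}
      with hA
    have hsA : s ∈ A := by
      refine ⟨hsI, fun y hy => ?_⟩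
      obtain rfl : y = s := le_antisymm hy.2 hy.1
      simp [hSs]
    have hAb : BddAbove A := ⟨t, fun x hx => hx.1.2⟩
    set z := sSup A with hz
    have hsz : s ≤ z := le_csSup hAb hsA
    have hzt : z ≤ t := csSup_le ⟨s, hsA⟩ fun x hx => hx.1.2
    have hzI : z ∈ Icc s t := ⟨hsz, hzt⟩
    have hbelow : ∀ y ∈ Ico s z, Em s - Ep y ≤ ∑' r, J y r + e * (y - s) := by
      intro y hy
      obtain ⟨x, hx, hyx⟩ := exists_lt_of_lt_csSup ⟨s, hsA⟩ hy.2
      exact hx.2 y ⟨hy.1, hyx.le⟩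
    have hzA : Em s - Ep z ≤ ∑' r, J z r + e * (z - s) := by
      rcases hsz.eq_or_lt with h | h
      · rw [← h]; simpa using hSs
      · refine le_of_forall_pos_le_add fun d hd => ?_
        obtain ⟨y, hy1, hy2⟩ := ((hleft z ⟨h, hzt⟩ d hd).and
          (Ico_mem_nhdsLT h)).exists
        have h1 := hbelow y hy2
        have h2 := hSjump z hzI y ⟨hy2.1, hy2.2.le.trans hzt⟩ hy2.2
        have h3 : e * (y - s) ≤ e * (z - s) :=
          mul_le_mul_of_nonneg_left (by linarith [hy2.2]) he.le
        linarith
    have hzt' : z = t := by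
      by_contra hne
      have hlt : z < t := lt_of_le_of_ne hzt hne
      obtain ⟨w, hw, hw2⟩ := (mem_nhdsGT_iff_exists_Ioc_subset).1
        (Filter.inter_mem (hright z ⟨hsz, hlt⟩ e he) (Ioc_mem_nhdsGT hlt))
      have hwA : w ∈ A := by
        refine ⟨⟨hsz.trans (le_of_lt hw), (hw2 ⟨hw, le_rfl⟩).2.2⟩, fun y hy => ?_⟩
        rcases lt_trichotomy y z with h | h | h
        · exact hbelow y ⟨hy.1, h⟩
        · rw [h]; exact hzA
        · have h1 := hw2 ⟨h, hy.2⟩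
          have h2 := hS z hzI y ⟨hy.1, h1.2.2⟩ h.le
          have h3 : Ep z - e * (y - z) ≤ Ep y := h1.1
          nlinarith
      exact absurd (le_csSup hAb hwA) (not_le.2 hw)
    intro x hx
    rcases hx.2.eq_or_lt with h | h
    · rw [h, ← hzt']; exact hzA
    · exact hbelow x ⟨hx.1, hzt'.symm ▸ h⟩
  have hge : Em s - Ep t ≤ ∑' r, J t r := by
    refine le_of_forall_pos_le_add fun d hd => ?_
    have h1 := main (d / (t - s + 1)) (div_pos hd (by linarith)) t htI
    have h2 : d / (t - s + 1) * (t - s) ≤ d := by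
      rw [div_mul_eq_mul_div, div_le_iff₀ (by linarith)]
      nlinarith
    linarith
  have hle : ∑' r, J t r ≤ Em s - Ep t := hsumt.tsum_le_of_sum_le hfin2
  have := hsumt.hasSum
  rwa [le_antisymm hle hge] at this

end JumpSum

variable {u₀ : X} {lam : ℝ} {σ τ : ℕ → ℝ} {U : ℕ → ℕ → X}

/-! ### Measurability and integrability of the power. -/

section Measurability

open MeasureTheory

theorem EnergyAssumptions.aestronglyMeasurable_timeDeriv (hF : EnergyAssumptions T F)
    (hT : 0 < T) {w : ℝ → X} (hw : AEStronglyMeasurable w (volume.restrict (Icc 0 T))) :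
    AEStronglyMeasurable (fun r => timeDeriv T F r (w r)) (volume.restrict (Icc 0 T)) := by
  have hc : Continuous fun p : ℝ × X => timeDeriv T F (projIcc 0 T hT.le p.1) p.2 := by
    refine (hF.continuousOn_timeDeriv hT).comp_continuous
      (f := fun p : ℝ × X => (((projIcc 0 T hT.le p.1 : Icc 0 T) : ℝ), p.2)) ?_ fun p =>
        ⟨(projIcc 0 T hT.le p.1).2, mem_univ _⟩
    exact (continuous_subtype_val.comp (continuous_projIcc.comp continuous_fst)).prodMk
      continuous_snd
  refine (hc.comp_aestronglyMeasurable
    (aestronglyMeasurable_id.prodMk hw)).congr ?_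
  filter_upwards [ae_restrict_mem measurableSet_Icc] with r hr
  simp [projIcc_of_mem hT.le hr]

theorem EnergyAssumptions.exists_abs_timeDeriv_le [FiniteDimensional ℝ X]
    (hF : EnergyAssumptions T F) (hT : 0 < T) (R : ℝ) :
    ∃ C : ℝ, 0 < C ∧ ∀ t ∈ Icc 0 T, ∀ u : X, ‖u‖ ≤ R → |timeDeriv T F t u| ≤ C := by
  have : ProperSpace X := FiniteDimensional.proper ℝ X
  obtain ⟨C, hC⟩ := (isCompact_Icc.prod (isCompact_closedBall (0 : X) R)).exists_bound_of_continuousOn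
    ((hF.continuousOn_timeDeriv hT).mono (prod_mono_right (subset_univ _)))
  refine ⟨max C 1, by positivity, fun t ht u hu => le_max_of_le_left ?_⟩
  exact hC (t, u) ⟨ht, by simpa using hu⟩

theorem intervalIntegrable_timeDeriv_comp (hF : EnergyAssumptions T F) (hT : 0 < T) {w : ℝ → X}
    (hw : AEStronglyMeasurable w (volume.restrict (Icc 0 T))) {C : ℝ}
    (hC : ∀ r ∈ Icc 0 T, |timeDeriv T F r (w r)| ≤ C) {a b : ℝ} (ha : a ∈ Icc 0 T)
    (hb : b ∈ Icc 0 T) :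
    IntervalIntegrable (fun r => timeDeriv T F r (w r)) volume a b := by
  have h : IntegrableOn (fun r => timeDeriv T F r (w r)) (Icc 0 T) := by
    refine Integrable.of_bound (hF.aestronglyMeasurable_timeDeriv hT hw) C ?_
    filter_upwards [ae_restrict_mem measurableSet_Icc] with r hr using hC r hr
  exact (h.mono_set (uIcc_subset_Icc ha hb)).intervalIntegrable

theorem stronglyMeasurable_floor_comp {Y : Type*} [TopologicalSpace Y] (x : ℕ → Y) (c : ℝ) :
    StronglyMeasurable fun r : ℝ => x ⌊r / c⌋₊ :=
  (StronglyMeasurable.of_discrete (f := x)).comp_measurable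
    (Nat.measurable_floor.comp (measurable_id.div_const c))

end Measurability

/-! ### A priori estimates for the scheme. -/

/-- A family of incremental minimization schemes, with quadratic penalization of strength `σ j` and
vanishing time steps `τ j`. -/
structure IsSchemeFamily (T : ℝ) (F : ℝ → X → ℝ) (u₀ : X) (lam : ℝ) (σ τ : ℕ → ℝ)
    (U : ℕ → ℕ → X) : Prop where
  energy : EnergyAssumptions T F
  T_pos : 0 < T
  lam_pos : 0 < lam
  σ_pos : ∀ j, 0 < σ j
  τ_pos : ∀ j, 0 < τ j
  σ_tendsto : Tendsto σ atTop (𝓝 lam)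
  τ_tendsto : Tendsto τ atTop (𝓝 0)
  start : ∀ j, U j 0 = u₀
  step : ∀ j k, k + 1 ≤ ⌊T / τ j⌋₊ → ∀ v,
    F ((k + 1 : ℕ) * τ j) (U j (k + 1)) + σ j / 2 * ‖U j (k + 1) - U j k‖ ^ 2 ≤
      F ((k + 1 : ℕ) * τ j) v + σ j / 2 * ‖v - U j k‖ ^ 2

/-- The energy drop in the `i`-th step of a scheme. -/
def stepCost (F : ℝ → X → ℝ) (c : ℝ) (x : ℕ → X) (i : ℕ) : ℝ :=
  F ((i + 1 : ℕ) * c) (x i) - F ((i + 1 : ℕ) * c) (x (i + 1))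

/-- The accumulated energy drops. -/
def cumCost (F : ℝ → X → ℝ) (c : ℝ) (x : ℕ → X) (k : ℕ) : ℝ :=
  ∑ i ∈ Finset.range k, stepCost F c x i

theorem cumCost_succ (c : ℝ) (x : ℕ → X) (k : ℕ) :
    cumCost F c x (k + 1) = cumCost F c x k + stepCost F c x k :=
  Finset.sum_range_succ _ _

namespace IsSchemeFamily

theorem comp (h : IsSchemeFamily T F u₀ lam σ τ U) {φ : ℕ → ℕ} (hφ : StrictMono φ) :
    IsSchemeFamily T F u₀ lam (σ ∘ φ) (τ ∘ φ) (U ∘ φ) where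
  energy := h.energy
  T_pos := h.T_pos
  lam_pos := h.lam_pos
  σ_pos _ := h.σ_pos _
  τ_pos _ := h.τ_pos _
  σ_tendsto := h.σ_tendsto.comp hφ.tendsto_atTop
  τ_tendsto := h.τ_tendsto.comp hφ.tendsto_atTop
  start _ := h.start _
  step _ := h.step _

theorem time_mem (h : IsSchemeFamily T F u₀ lam σ τ U) {j k : ℕ} (hk : k ≤ ⌊T / τ j⌋₊) :
    (k : ℝ) * τ j ∈ Icc 0 T := by
  have h1 := h.τ_pos j
  refine ⟨by positivity, ?_⟩
  rw [← le_div_iff₀ h1]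
  exact (Nat.le_floor_iff (div_nonneg h.T_pos.le h1.le)).1 hk

/-- Minimality rearranged so that, for a well chosen `v`, the bracket is nearly the residual at the
starting point of the step. -/
theorem le_stepCost (h : IsSchemeFamily T F u₀ lam σ τ U) {j k : ℕ}
    (hk : k + 1 ≤ ⌊T / τ j⌋₊) (v : X) :
    σ j / 2 * ‖U j (k + 1) - U j k‖ ^ 2 + (F ((k + 1 : ℕ) * τ j) (U j k) -
      F ((k + 1 : ℕ) * τ j) v - σ j / 2 * ‖v - U j k‖ ^ 2) ≤ stepCost F (τ j) (U j) k := by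
  have := h.step j k hk v
  unfold stepCost
  linarith

theorem norm_sq_le_stepCost (h : IsSchemeFamily T F u₀ lam σ τ U) {j k : ℕ}
    (hk : k + 1 ≤ ⌊T / τ j⌋₊) :
    σ j / 2 * ‖U j (k + 1) - U j k‖ ^ 2 ≤ stepCost F (τ j) (U j) k := by
  simpa using h.le_stepCost hk (U j k)

theorem stepCost_nonneg (h : IsSchemeFamily T F u₀ lam σ τ U) {j k : ℕ}
    (hk : k + 1 ≤ ⌊T / τ j⌋₊) : 0 ≤ stepCost F (τ j) (U j) k := by
  have := h.σ_pos j
  exact le_trans (by positivity) (h.norm_sq_le_stepCost hk)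

theorem cumCost_mono (h : IsSchemeFamily T F u₀ lam σ τ U) {j k l : ℕ} (hkl : k ≤ l)
    (hl : l ≤ ⌊T / τ j⌋₊) : cumCost F (τ j) (U j) k ≤ cumCost F (τ j) (U j) l := by
  induction l, hkl using Nat.le_induction with
  | base => exact le_rfl
  | succ l hkl ih =>
    rw [cumCost_succ]
    linarith [ih (by omega), h.stepCost_nonneg hl]

theorem stepCost_le_cumCost_sub (h : IsSchemeFamily T F u₀ lam σ τ U) {j k i l : ℕ} (hki : k ≤ i)
    (hil : i < l) (hl : l ≤ ⌊T / τ j⌋₊) :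
    stepCost F (τ j) (U j) i ≤ cumCost F (τ j) (U j) l - cumCost F (τ j) (U j) k := by
  have h1 := h.cumCost_mono hki (show i ≤ ⌊T / τ j⌋₊ by omega)
  have h2 := h.cumCost_mono (show i + 1 ≤ l from hil) hl
  rw [cumCost_succ] at h2
  linarith

theorem exists_norm_le (h : IsSchemeFamily T F u₀ lam σ τ U) :
    ∃ R : ℝ, 0 < R ∧ ∀ j k, k ≤ ⌊T / τ j⌋₊ → ‖U j k‖ ≤ R := by
  obtain ⟨C₁, C₂, h1, h2, h3, h4, -⟩ := h.energy.exists_growth h.T_pos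
  have h0 : (0 : ℝ) ∈ Icc 0 T := left_mem_Icc.2 h.T_pos.le
  obtain ⟨R, hR, hR'⟩ := h.energy.exists_norm_le h.T_pos
    (Real.exp (C₁ * T) * (F 0 u₀ + C₂) - C₂)
  refine ⟨R, hR, fun j k hk => hR' _ (h.time_mem hk) _ ?_⟩
  have key : F (k * τ j) (U j k) + C₂ ≤ Real.exp (C₁ * (k * τ j)) * (F 0 u₀ + C₂) := by
    induction k with
    | zero => simp [h.start]
    | succ k ih =>
      -- Moving time with the state frozen costs an exponential factor; the minimization at fixed
      -- time only lowers the energy.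
      have ih := ih (by omega)
      have hk' := h.time_mem (j := j) (show k ≤ _ by omega)
      have h5 := h4 _ hk' _ (h.time_mem hk)
        (mul_le_mul_of_nonneg_right (by push_cast; linarith) (h.τ_pos j).le) (U j k)
      have h6 := h.stepCost_nonneg hk
      unfold stepCost at h6
      have h7 := mul_le_mul_of_nonneg_left ih
        (Real.exp_pos (C₁ * ((k + 1 : ℕ) * τ j - k * τ j))).le
      rw [← mul_assoc, ← Real.exp_add, ← mul_add, sub_add_cancel] at h7
      linarith
  have h5 : Real.exp (C₁ * (k * τ j)) * (F 0 u₀ + C₂) ≤ Real.exp (C₁ * T) * (F 0 u₀ + C₂) :=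
    mul_le_mul_of_nonneg_right (Real.exp_le_exp.2
      (mul_le_mul_of_nonneg_left (h.time_mem hk).2 h1.le)) (h3 0 h0 u₀)
  linarith

theorem floor_le (h : IsSchemeFamily T F u₀ lam σ τ U) (j : ℕ) {r : ℝ} (hr : r ∈ Icc 0 T) :
    ⌊r / τ j⌋₊ ≤ ⌊T / τ j⌋₊ :=
  Nat.floor_le_floor (div_le_div_of_nonneg_right hr.2 (h.τ_pos j).le)

variable [FiniteDimensional ℝ X]

theorem intervalIntegrable_floor (h : IsSchemeFamily T F u₀ lam σ τ U) (j : ℕ) {a b : ℝ}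
    (ha : a ∈ Icc 0 T) (hb : b ∈ Icc 0 T) :
    IntervalIntegrable (fun r => timeDeriv T F r (U j ⌊r / τ j⌋₊)) MeasureTheory.volume a b := by
  obtain ⟨R, -, hR⟩ := h.exists_norm_le
  obtain ⟨C, -, hC⟩ := h.energy.exists_abs_timeDeriv_le h.T_pos R
  exact intervalIntegrable_timeDeriv_comp h.energy h.T_pos
    (stronglyMeasurable_floor_comp (U j) (τ j)).aestronglyMeasurable
    (fun r hr => hC r hr _ (hR j _ (h.floor_le j hr))) ha hb

/-- The discrete energy identity. -/
theorem cumCost_eq (h : IsSchemeFamily T F u₀ lam σ τ U) {j k : ℕ} (hk : k ≤ ⌊T / τ j⌋₊) :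
    cumCost F (τ j) (U j) k = F 0 u₀ - F (k * τ j) (U j k) +
      ∫ r in (0 : ℝ)..k * τ j, timeDeriv T F r (U j ⌊r / τ j⌋₊) := by
  induction k with
  | zero => simp [cumCost, h.start]
  | succ k ih =>
    have hk' : k ≤ ⌊T / τ j⌋₊ := by omega
    have h0 : (0 : ℝ) ∈ Icc 0 T := left_mem_Icc.2 h.T_pos.le
    have hpos := h.τ_pos j
    have hle : (k : ℝ) * τ j ≤ (k + 1 : ℕ) * τ j :=
      mul_le_mul_of_nonneg_right (by push_cast; linarith) hpos.le
    rw [cumCost_succ, ih hk', ← intervalIntegral.integral_add_adjacent_intervals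
      (h.intervalIntegrable_floor j h0 (h.time_mem hk'))
      (h.intervalIntegrable_floor j (h.time_mem hk') (h.time_mem hk))]
    -- The floor index freezes the state at `U j k` while time moves to the next node; only the
    -- right end point differs, a null set.
    have h1 : ∫ r in (k : ℝ) * τ j..(k + 1 : ℕ) * τ j, timeDeriv T F r (U j ⌊r / τ j⌋₊) =
        ∫ r in (k : ℝ) * τ j..(k + 1 : ℕ) * τ j, timeDeriv T F r (U j k) := by
      refine intervalIntegral.integral_congr_ae ?_
      filter_upwards [MeasureTheory.Measure.ae_ne MeasureTheory.volume ((k + 1 : ℕ) * τ j)]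
        with r hr hr2
      rw [uIoc_of_le hle] at hr2
      have : ⌊r / τ j⌋₊ = k := by
        rw [Nat.floor_eq_iff (div_nonneg ((h.time_mem hk').1.trans hr2.1.le) hpos.le),
          le_div_iff₀ hpos, div_lt_iff₀ hpos]
        refine ⟨hr2.1.le, ?_⟩
        have := lt_of_le_of_ne hr2.2 hr
        push_cast at this
        exact this
      rw [this]
    rw [h1, h.energy.integral_timeDeriv h.T_pos (h.time_mem hk') (h.time_mem hk) hle]
    unfold stepCost
    ring

theorem exists_cumCost_le (h : IsSchemeFamily T F u₀ lam σ τ U) :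
    ∃ C : ℝ, ∀ j k, k ≤ ⌊T / τ j⌋₊ → cumCost F (τ j) (U j) k ≤ C := by
  obtain ⟨R, -, hR⟩ := h.exists_norm_le
  obtain ⟨C, hC0, hC⟩ := h.energy.exists_abs_timeDeriv_le h.T_pos R
  obtain ⟨B, hB⟩ := h.energy.exists_lower_bound h.T_pos
  refine ⟨F 0 u₀ + B + C * T, fun j k hk => ?_⟩
  rw [h.cumCost_eq hk]
  have hk' := h.time_mem hk
  have h1 := hB _ hk' (U j k)
  have h2 := intervalIntegral.norm_integral_le_of_norm_le_const (a := 0) (b := k * τ j)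
    (f := fun r => timeDeriv T F r (U j ⌊r / τ j⌋₊)) (C := C) (fun r hr => by
      rw [uIoc_of_le hk'.1] at hr
      have hr' : r ∈ Icc 0 T := ⟨hr.1.le, hr.2.trans hk'.2⟩
      exact hC r hr' _ (hR j _ (h.floor_le j hr')))
  rw [sub_zero, abs_of_nonneg hk'.1] at h2
  have h3 := (le_abs_self _).trans h2
  have := mul_le_mul_of_nonneg_left hk'.2 hC0.le
  linarith

end IsSchemeFamily

/-! ### Finiteness of stable points and residual bounds away from them. -/

theorem isClosed_setOf_isStable (hF : EnergyAssumptions T F) {t : ℝ} (ht : t ∈ Icc 0 T) :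
    IsClosed {u : X | IsStable F lam t u} := by
  simp only [IsStable, ofPred_forall]
  refine isClosed_iInter fun v => isClosed_le (hF.continuous ht) ?_
  fun_prop

/-- The set is compact, and discrete because stable points are critical and (F3) isolates critical
points. -/
theorem finite_isStable [FiniteDimensional ℝ X] (hF : EnergyAssumptions T F) {t : ℝ}
    (ht : t ∈ Icc 0 T) (R : ℝ) :
    {u : X | IsStable F lam t u ∧ ‖u‖ ≤ R}.Finite := by
  have : ProperSpace X := FiniteDimensional.proper ℝ X
  have hc : IsCompact {u : X | IsStable F lam t u ∧ ‖u‖ ≤ R} := by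
    convert (isCompact_closedBall (0 : X) R).inter_left
      (isClosed_setOf_isStable (lam := lam) hF ht) using 1
    ext u
    simp
  refine hc.induction_on (p := Set.Finite) finite_empty (fun s t hst ht => ht.subset hst)
    (fun s t => Set.Finite.union) fun x hx => ⟨{x}, ?_, finite_singleton x⟩
  obtain ⟨r, hr, h⟩ := hF.F3 t ht x (hx.1.mem_criticalSet hF ht)
  refine Metric.mem_nhdsWithin_iff.2 ⟨r, hr, ?_⟩
  rintro y ⟨hy1, hy2⟩
  exact h y (hy2.1.mem_criticalSet hF ht) hy1

/-- On a compact set without stable points, the residual is bounded away from zero, also after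
small perturbations of the time and of the penalization. -/
theorem exists_residual_lower_bound (hF : EnergyAssumptions T F) {t₀ : ℝ} (ht₀ : t₀ ∈ Icc 0 T)
    {K : Set X} (hK : IsCompact K) (hKs : ∀ x ∈ K, ¬ IsStable F lam t₀ x) :
    ∃ γ > 0, ∃ δ > 0, ∀ t ∈ Icc 0 T, |t - t₀| < δ → ∀ s, |s - lam| < δ → ∀ x ∈ K, ∃ v,
      γ < F t x - F t v - s / 2 * ‖v - x‖ ^ 2 := by
  refine hK.induction_on (p := fun K => ∃ γ > 0, ∃ δ > 0, ∀ t ∈ Icc 0 T, |t - t₀| < δ →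
    ∀ s, |s - lam| < δ → ∀ x ∈ K, ∃ v, γ < F t x - F t v - s / 2 * ‖v - x‖ ^ 2) ?_ ?_ ?_ ?_
  · exact ⟨1, one_pos, 1, one_pos, by simp⟩
  · rintro s t hst ⟨γ, hγ, δ, hδ, h⟩
    exact ⟨γ, hγ, δ, hδ, fun t ht htd s hs x hx => h t ht htd s hs x (hst hx)⟩
  · rintro K₁ K₂ ⟨γ₁, hγ₁, δ₁, hδ₁, h₁⟩ ⟨γ₂, hγ₂, δ₂, hδ₂, h₂⟩
    refine ⟨min γ₁ γ₂, lt_min hγ₁ hγ₂, min δ₁ δ₂, lt_min hδ₁ hδ₂, ?_⟩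
    rintro t ht htd s hs x (hx | hx)
    · obtain ⟨v, hv⟩ := h₁ t ht (htd.trans_le (min_le_left _ _)) s
        (hs.trans_le (min_le_left _ _)) x hx
      exact ⟨v, (min_le_left _ _).trans_lt hv⟩
    · obtain ⟨v, hv⟩ := h₂ t ht (htd.trans_le (min_le_right _ _)) s
        (hs.trans_le (min_le_right _ _)) x hx
      exact ⟨v, (min_le_right _ _).trans_lt hv⟩
  · intro x hx
    have hx' := hKs x hx
    simp only [IsStable, not_forall, not_le] at hx'
    obtain ⟨v, hv⟩ := hx'
    have hpos : 0 < F t₀ x - F t₀ v - lam / 2 * ‖v - x‖ ^ 2 := by linarith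
    set γ := (F t₀ x - F t₀ v - lam / 2 * ‖v - x‖ ^ 2) / 2 with hγ
    have hcont : ContinuousOn (fun p : ℝ × ℝ × X =>
        F p.1 p.2.2 - F p.1 v - p.2.1 / 2 * ‖v - p.2.2‖ ^ 2) (Icc 0 T ×ˢ univ) := by
      refine (ContinuousOn.sub ?_ ?_).sub (by fun_prop)
      · exact hF.continuousOn.comp (f := fun p : ℝ × ℝ × X => (p.1, p.2.2)) (by fun_prop)
          fun p hp => ⟨hp.1, mem_univ _⟩
      · exact hF.continuousOn.comp (f := fun p : ℝ × ℝ × X => (p.1, v)) (by fun_prop)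
          fun p hp => ⟨hp.1, mem_univ _⟩
    have h1 := (hcont (t₀, lam, x) ⟨ht₀, mem_univ _⟩).eventually
      (lt_mem_nhds (show γ < F t₀ x - F t₀ v - lam / 2 * ‖v - x‖ ^ 2 by linarith))
    obtain ⟨δ, hδ, h2⟩ := Metric.mem_nhdsWithin_iff.1 h1
    refine ⟨Metric.ball x δ, mem_nhdsWithin_of_mem_nhds (Metric.ball_mem_nhds x hδ), γ,
      by positivity, δ, hδ, fun t ht htd s hs y hy => ⟨v, ?_⟩⟩
    refine h2 (show (t, s, y) ∈ _ from ⟨?_, ht, mem_univ _⟩)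
    simp only [Metric.mem_ball, Prod.dist_eq, max_lt_iff, Real.dist_eq]
    exact ⟨htd, hs, hy⟩

/-- Finitely many small, well separated balls contain the stable points, and the residual is
bounded away from zero elsewhere. -/
theorem exists_separation [FiniteDimensional ℝ X] (hF : EnergyAssumptions T F) {t₀ : ℝ}
    (ht₀ : t₀ ∈ Icc 0 T) (lam R : ℝ) :
    ∃ S : Finset X, ∀ r₀ > 0, ∃ r > 0, r ≤ r₀ ∧ (∀ p ∈ S, ∀ q ∈ S, dist p q < 3 * r → p = q) ∧
      ∃ γ > 0, ∃ δ > 0, ∀ t ∈ Icc 0 T, |t - t₀| < δ → ∀ s, |s - lam| < δ → ∀ x, ‖x‖ ≤ R →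
        (∀ p ∈ S, r ≤ dist x p) → ∃ v, γ < F t x - F t v - s / 2 * ‖v - x‖ ^ 2 := by
  have : ProperSpace X := FiniteDimensional.proper ℝ X
  have hfin := finite_isStable (lam := lam) hF ht₀ R
  -- The finite set precedes the radius, because `exists_transitionCost_le` picks the radius in
  -- terms of its cardinality.
  refine ⟨hfin.toFinset, fun r₀ hr₀ => ?_⟩
  obtain ⟨C, hC, hsep⟩ : ∃ C > 0, ∀ p ∈ hfin.toFinset, ∀ q ∈ hfin.toFinset, dist p q < C →
      p = q := by
    obtain ⟨C, hC, h⟩ := einfsep_pos.1 hfin.einfsep_pos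
    have hC' : 0 < min C 1 := lt_min hC one_pos
    have htop : min C 1 ≠ ⊤ := ne_top_of_le_ne_top ENNReal.one_ne_top (min_le_right _ _)
    refine ⟨(min C 1).toReal, ENNReal.toReal_pos hC'.ne' htop, fun p hp q hq hpq => ?_⟩
    by_contra hne
    have h1 := (min_le_left C 1).trans
      (h p (hfin.mem_toFinset.1 hp) q (hfin.mem_toFinset.1 hq) hne)
    rw [edist_dist, ← ENNReal.ofReal_toReal htop] at h1
    have h2 := (ENNReal.ofReal_le_ofReal_iff dist_nonneg).1 h1
    linarith
  have hr : 0 < min r₀ (C / 3) := lt_min hr₀ (by positivity)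
  refine ⟨min r₀ (C / 3), hr, min_le_left _ _, fun p hp q hq hpq => hsep p hp q hq ?_, ?_⟩
  · have := min_le_right r₀ (C / 3)
    linarith
  set r := min r₀ (C / 3)
  have hK : IsCompact {x : X | ‖x‖ ≤ R ∧ ∀ p ∈ hfin.toFinset, r ≤ dist x p} := by
    have h1 : IsClosed {x : X | ∀ p ∈ hfin.toFinset, r ≤ dist x p} := by
      simp only [ofPred_forall]
      exact isClosed_iInter fun p => isClosed_iInter fun _ =>
        isClosed_le continuous_const (by fun_prop)
    convert (isCompact_closedBall (0 : X) R).inter_right h1 using 1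
    ext u
    simp
  obtain ⟨γ, hγ, δ, hδ, h⟩ := exists_residual_lower_bound (lam := lam) hF ht₀ hK (by
    rintro x ⟨hx1, hx2⟩ hx3
    have := hx2 x (hfin.mem_toFinset.2 ⟨hx3, hx1⟩)
    rw [dist_self] at this
    linarith)
  exact ⟨γ, hγ, δ, hδ, fun t ht htd s hs x hx1 hx2 => h t ht htd s hs x ⟨hx1, hx2⟩⟩

/-! ### Cost controls the oscillation of the discrete solutions. -/

namespace IsSchemeFamily

variable [FiniteDimensional ℝ X]

/-- With small total cost no step starts outside the balls around the stable points, and no step is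
long enough to pass from one ball to another. -/
theorem exists_oscillation_at (h : IsSchemeFamily T F u₀ lam σ τ U) {t₀ : ℝ} (ht₀ : t₀ ∈ Icc 0 T)
    {η : ℝ} (hη : 0 < η) :
    ∃ c > 0, ∃ δ > 0, ∀ᶠ j in atTop, ∀ k l, k ≤ l → l ≤ ⌊T / τ j⌋₊ →
      |k * τ j - t₀| < δ → |l * τ j - t₀| < δ →
      cumCost F (τ j) (U j) l - cumCost F (τ j) (U j) k < c → dist (U j k) (U j l) < η := by
  obtain ⟨R, -, hR⟩ := h.exists_norm_le
  obtain ⟨S, hS⟩ := exists_separation h.energy ht₀ lam R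
  obtain ⟨r, hr, hrη, hsep, γ, hγ, δ, hδ, hout⟩ := hS (η / 3) (by positivity)
  have hlam := h.lam_pos
  -- A step starting outside the balls costs more than γ. A step of length at least r costs at least
  -- (lam/4)r², since eventually σ j > lam/2.
  refine ⟨min γ (lam / 4 * r ^ 2), by positivity, δ, hδ, ?_⟩
  filter_upwards [h.σ_tendsto.eventually (Metric.ball_mem_nhds lam hδ),
    h.σ_tendsto.eventually (lt_mem_nhds (half_lt_self hlam))] with j hj1 hj2
  intro k l hkl hl hk hl' hcost
  rcases hkl.eq_or_lt with rfl | hkl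
  · simpa using hη
  have hτ := h.τ_pos j
  have hnear : ∀ i, k ≤ i → i < l → ∃ p ∈ S, dist (U j i) p < r := by
    intro i hki hil
    by_contra! hcon
    have h1 : (k : ℝ) * τ j ≤ (i + 1 : ℕ) * τ j :=
      mul_le_mul_of_nonneg_right (by exact_mod_cast (by omega)) hτ.le
    have h2 : ((i + 1 : ℕ) : ℝ) * τ j ≤ l * τ j :=
      mul_le_mul_of_nonneg_right (by exact_mod_cast hil) hτ.le
    rw [abs_lt] at hk hl'
    obtain ⟨v, hv⟩ := hout ((i + 1 : ℕ) * τ j) (h.time_mem (by omega))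
      (abs_lt.2 ⟨by linarith, by linarith⟩) (σ j) (by simpa [Real.dist_eq] using hj1) (U j i)
      (hR j i (by omega)) hcon
    have h3 := h.le_stepCost (show i + 1 ≤ ⌊T / τ j⌋₊ by omega) v
    have h4 := h.stepCost_le_cumCost_sub hki hil hl
    have h5 : 0 ≤ σ j / 2 * ‖U j (i + 1) - U j i‖ ^ 2 := by
      have := h.σ_pos j
      positivity
    have := min_le_left γ (lam / 4 * r ^ 2)
    linarith
  have hstep : ∀ i, k ≤ i → i < l → dist (U j (i + 1)) (U j i) < r := by
    intro i hki hil
    have h3 := h.norm_sq_le_stepCost (show i + 1 ≤ ⌊T / τ j⌋₊ by omega)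
    have h4 := h.stepCost_le_cumCost_sub hki hil hl
    have := min_le_right γ (lam / 4 * r ^ 2)
    rw [dist_eq_norm]
    refine lt_of_pow_lt_pow_left₀ 2 hr.le ?_
    have h6 : lam / 4 * ‖U j (i + 1) - U j i‖ ^ 2 < lam / 4 * r ^ 2 := by
      have : lam / 4 * ‖U j (i + 1) - U j i‖ ^ 2 ≤ σ j / 2 * ‖U j (i + 1) - U j i‖ ^ 2 :=
        mul_le_mul_of_nonneg_right (by linarith) (by positivity)
      linarith
    exact lt_of_mul_lt_mul_left h6 (by positivity)
  obtain ⟨p, hp, hpk⟩ := hnear k le_rfl hkl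
  have hall : ∀ i, k ≤ i → i < l → dist (U j i) p < r := by
    intro i hki
    induction i, hki using Nat.le_induction with
    | base => exact fun _ => hpk
    | succ i hki ih =>
      intro hil
      obtain ⟨q, hq, hqi⟩ := hnear (i + 1) (by omega) hil
      have h1 := ih (by omega)
      have h2 := hstep i hki (by omega)
      have h3 : dist q p < 3 * r := by
        have h4 := dist_triangle4 q (U j (i + 1)) (U j i) p
        rw [dist_comm q (U j (i + 1))] at h4
        linarith
      rwa [hsep q hq p hp h3] at hqi
  -- The cost sees only starting points, so the last iterate may lie outside the ball; one more
  -- short step accounts for the third r in 3r ≤ η.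
  obtain ⟨n, rfl⟩ : ∃ n, l = n + 1 := ⟨l - 1, by omega⟩
  have h1 := hall n (by omega) (by omega)
  have h2 := hstep n (by omega) (by omega)
  have h3 := dist_triangle4 (U j k) p (U j n) (U j (n + 1))
  rw [dist_comm p, dist_comm (U j n) (U j (n + 1))] at h3
  linarith

/-- Compactness of [0,T] makes the constants independent of the base time. -/
theorem exists_oscillation (h : IsSchemeFamily T F u₀ lam σ τ U) {η : ℝ} (hη : 0 < η) :
    ∃ c > 0, ∃ δ > 0, ∀ᶠ j in atTop, ∀ k l, k ≤ l → l ≤ ⌊T / τ j⌋₊ →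
      (l : ℝ) * τ j - k * τ j < δ →
      cumCost F (τ j) (U j) l - cumCost F (τ j) (U j) k < c → dist (U j k) (U j l) < η := by
  have key := (isCompact_Icc (a := (0 : ℝ)) (b := T)).induction_on
    (p := fun s => ∃ c > 0, ∃ δ > 0, ∀ᶠ j in atTop, ∀ k l, k ≤ l → l ≤ ⌊T / τ j⌋₊ →
      (k : ℝ) * τ j ∈ s → (l : ℝ) * τ j - k * τ j < δ →
      cumCost F (τ j) (U j) l - cumCost F (τ j) (U j) k < c → dist (U j k) (U j l) < η)
    ⟨1, one_pos, 1, one_pos, by simp⟩ ?_ ?_ ?_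
  · obtain ⟨c, hc, δ, hδ, hj⟩ := key
    refine ⟨c, hc, δ, hδ, hj.mono fun j hj k l hkl hl => hj k l hkl hl ?_⟩
    exact h.time_mem (by omega)
  · rintro s t hst ⟨c, hc, δ, hδ, hj⟩
    exact ⟨c, hc, δ, hδ, hj.mono fun j hj k l hkl hl hk => hj k l hkl hl (hst hk)⟩
  · rintro s t ⟨c₁, hc₁, δ₁, hδ₁, h₁⟩ ⟨c₂, hc₂, δ₂, hδ₂, h₂⟩
    refine ⟨min c₁ c₂, lt_min hc₁ hc₂, min δ₁ δ₂, lt_min hδ₁ hδ₂, ?_⟩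
    filter_upwards [h₁, h₂] with j h₁ h₂
    rintro k l hkl hl (hk | hk) hd hcost
    · exact h₁ k l hkl hl hk (hd.trans_le (min_le_left _ _)) (hcost.trans_le (min_le_left _ _))
    · exact h₂ k l hkl hl hk (hd.trans_le (min_le_right _ _)) (hcost.trans_le (min_le_right _ _))
  · intro t₀ ht₀
    obtain ⟨c, hc, δ, hδ, hj⟩ := h.exists_oscillation_at ht₀ hη
    refine ⟨Metric.ball t₀ (δ / 2),
      mem_nhdsWithin_of_mem_nhds (Metric.ball_mem_nhds _ (half_pos hδ)), c, hc, δ / 2,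
      half_pos hδ, ?_⟩
    filter_upwards [hj] with j hj k l hkl hl hk hd hcost
    rw [Metric.mem_ball, Real.dist_eq] at hk
    have h1 : (k : ℝ) * τ j ≤ l * τ j :=
      mul_le_mul_of_nonneg_right (by exact_mod_cast hkl) (h.τ_pos j).le
    refine hj k l hkl hl (hk.trans (half_lt_self hδ)) ?_ hcost
    rw [abs_lt] at hk ⊢
    constructor <;> linarith

end IsSchemeFamily

/-! ### Chains, loop erasure and the transition cost. -/

variable {t : ℝ}

/-- `StepChain F lam t a b M`: there is a chain from `a` to `b` whose cost, without the residual of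
the end point `b`, is at most `M`. -/
inductive StepChain (F : ℝ → X → ℝ) (lam t : ℝ) : X → X → ℝ → Prop
  | refl (a : X) {M : ℝ} (hM : 0 ≤ M) : StepChain F lam t a a M
  | cons {a b c : X} {M M' : ℝ} (h : StepChain F lam t b c M)
      (hM : lam / 2 * ‖a - b‖ ^ 2 + residual F lam t a + M ≤ M') : StepChain F lam t a c M'

namespace StepChain

theorem mono {a b : X} {M M' : ℝ} (h : StepChain F lam t a b M) (hM : M ≤ M') :
    StepChain F lam t a b M' := by
  cases h with
  | refl _ h => exact refl _ (h.trans hM)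
  | cons h h' => exact cons h (h'.trans hM)

theorem single {a b : X} {M : ℝ} (hM : lam / 2 * ‖a - b‖ ^ 2 + residual F lam t a ≤ M) :
    StepChain F lam t a b M :=
  cons (refl b le_rfl) (by simpa using hM)

/-- Bounds simply add because the residual of the end point is not counted. -/
theorem trans {a b c : X} {M M' : ℝ} (h : StepChain F lam t a b M)
    (h' : StepChain F lam t b c M') : StepChain F lam t a c (M + M') := by
  induction h with
  | refl _ h => exact h'.mono (by linarith)
  | cons _ hM ih => exact cons (ih h') (by linarith)

theorem exists_chain {a b : X} {M : ℝ} (h : StepChain F lam t a b M) :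
    ∃ (N : ℕ) (w : ℕ → X), w 0 = a ∧ w N = b ∧
      chainCost F lam t N w ≤ M + residual F lam t b := by
  induction h with
  | refl a h => exact ⟨0, fun _ => a, rfl, rfl, by simpa [chainCost] using h⟩
  | @cons a b c M M' _ hM ih =>
    obtain ⟨N, w, h0, hN, hw⟩ := ih
    refine ⟨N + 1, fun n => Nat.casesOn n a w, rfl, hN, ?_⟩
    unfold chainCost at hw ⊢
    rw [Finset.sum_range_succ', Finset.sum_range_succ' _ (N + 1)]
    simp only [h0]
    change ∑ i ∈ Finset.range N, lam / 2 * ‖w i - w (i + 1)‖ ^ 2 + lam / 2 * ‖a - b‖ ^ 2 +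
      (∑ i ∈ Finset.range (N + 1), residual F lam t (w i) + residual F lam t a) ≤ _
    linarith

end StepChain

section TransitionCost

theorem transitionCost_le_chainCost (hF : EnergyAssumptions T F) (hT : 0 < T) (hlam : 0 < lam)
    (ht : t ∈ Icc 0 T) {N : ℕ} (hN : 1 ≤ N) (w : ℕ → X) :
    transitionCost F lam t (w 0) (w N) ≤ chainCost F lam t N w := by
  refine csInf_le ⟨0, ?_⟩ ⟨N, w, hN, rfl, rfl, rfl⟩
  rintro _ ⟨N, w, -, -, -, rfl⟩
  exact add_nonneg (Finset.sum_nonneg fun i _ => by positivity)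
    (Finset.sum_nonneg fun i _ => residual_nonneg hF hT hlam ht _)

/-- The cost of a chain is invariant under reversal: the scheme runs from the left to the right
limit, whereas the energy balance uses the opposite order. Distinct end points rule out N = 0. -/
theorem transitionCost_le_of_stepChain (hF : EnergyAssumptions T F) (hT : 0 < T) (hlam : 0 < lam)
    (ht : t ∈ Icc 0 T) {a b : X} {M : ℝ} (hab : a ≠ b)
    (h : StepChain F lam t a b M) :
    transitionCost F lam t b a ≤ M + residual F lam t b := by
  obtain ⟨N, w, h0, hN, hw⟩ := h.exists_chain
  have hN1 : 1 ≤ N := by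
    rcases Nat.eq_zero_or_pos N with rfl | h
    · exact absurd (h0.symm.trans hN) hab
    · exact h
  have key : chainCost F lam t N (fun i => w (N - i)) = chainCost F lam t N w := by
    unfold chainCost
    congr 1
    · rw [← Finset.sum_range_reflect]
      refine Finset.sum_congr rfl fun i hi => ?_
      have hi := Finset.mem_range.1 hi
      dsimp only
      rw [show N - (N - 1 - i) = i + 1 by omega, show N - (N - 1 - i + 1) = i by omega,
        norm_sub_rev]
    · rw [← Finset.sum_range_reflect]
      refine Finset.sum_congr rfl fun i hi => ?_
      have hi := Finset.mem_range.1 hi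
      dsimp only
      rw [show N - (N + 1 - 1 - i) = i by omega]
  have := transitionCost_le_chainCost hF hT hlam ht hN1 (fun i => w (N - i))
  simp only [Nat.sub_zero, Nat.sub_self, h0, hN] at this
  rw [key] at this
  exact this.trans hw

/-- Testing the residual at w(i+1) with w(i) bounds the energy increase by the displacement plus
that residual; the sum telescopes and the residual at w(0) is left over. -/
theorem sub_le_transitionCost (hF : EnergyAssumptions T F) (hT : 0 < T) (hlam : 0 < lam)
    (ht : t ∈ Icc 0 T) (a b : X) : F t b - F t a ≤ transitionCost F lam t a b := by
  refine le_csInf ⟨_, 1, fun n => if n = 0 then a else b, le_rfl, by simp, by simp, rfl⟩ ?_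
  rintro _ ⟨N, w, -, rfl, rfl, rfl⟩
  unfold chainCost
  rw [Finset.sum_range_succ', ← add_assoc, ← Finset.sum_add_distrib,
    ← Finset.sum_range_sub (fun i => F t (w i))]
  refine le_add_of_le_of_nonneg (Finset.sum_le_sum fun i _ => ?_)
    (residual_nonneg hF hT hlam ht _)
  have := sub_le_residual hF hT hlam ht (w (i + 1)) (w i)
  linarith

end TransitionCost

/-- Erasing loops: a trajectory whose step costs are nearly bounded by the increments of `C`, with
a relative error away from finitely many small balls, gives rise to a chain whose cost is nearly
bounded by the total increment of `C`. -/
theorem stepChain_of_balls (hlam : 0 < lam) {x : ℕ → X} {C : ℕ → ℝ} {l : ℕ} {r θ κ : ℝ}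
    (hθ : 0 ≤ θ) (hκ : 0 ≤ κ) (hC : ∀ i < l, C i ≤ C (i + 1)) (n k : ℕ) (hkn : k + n = l)
    (S : Finset X)
    (hin : ∀ i, k ≤ i → i < l → lam / 2 * ‖x i - x (i + 1)‖ ^ 2 + residual F lam t (x i) ≤
      C (i + 1) - C i + θ)
    (hout : ∀ i, k ≤ i → i < l → (∀ p ∈ S, r ≤ dist (x i) p) →
      lam / 2 * ‖x i - x (i + 1)‖ ^ 2 + residual F lam t (x i) ≤ (1 + κ) * (C (i + 1) - C i)) :
    StepChain F lam t (x k) (x l)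
      ((1 + κ) * (C l - C k) + S.card * (2 * θ + 2 * lam * r ^ 2)) := by
  classical
  have hCm : ∀ a b, a ≤ b → b ≤ l → C a ≤ C b := by
    intro a b hab
    induction b, hab using Nat.le_induction with
    | base => exact fun _ => le_rfl
    | succ b _ ih => exact fun hb => (ih (by omega)).trans (hC b hb)
  induction n using Nat.strong_induction_on generalizing k S with
  | _ n ih =>
  rcases Nat.eq_zero_or_pos n with rfl | hn
  · obtain rfl : k = l := by omega
    exact .refl _ (by rw [sub_self]; positivity)
  -- Outside all balls the step is kept, with relative error only.
  by_cases hS : ∀ p ∈ S, r ≤ dist (x k) p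
  · have h1 := ih (n - 1) (by omega) (k + 1) (by omega) S (fun i hi => hin i (by omega))
      (fun i hi => hout i (by omega))
    refine (StepChain.trans (.single (hout k le_rfl (by omega) hS)) h1).mono (le_of_eq ?_)
    ring
  · push Not at hS
    obtain ⟨p, hp, hpk⟩ := hS
    -- Jump straight to the last visit `b` to this ball: length at most 2r, so quadratic cost at
    -- most 2·lam·r². The ball is then left for good and `p` is dropped. The two θ come from the
    -- residual at `x k` and from the step leaving `x b`.
    obtain ⟨b, ⟨hkb, hbl, hb⟩, hmax⟩ : ∃ b, (k ≤ b ∧ b ≤ l ∧ dist (x b) p < r) ∧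
        ∀ i, b < i → i ≤ l → r ≤ dist (x i) p := by
      obtain ⟨b, hb, hmax⟩ := ((Finset.Icc k l).filter fun i => dist (x i) p < r).exists_max_image
        id ⟨k, by simp [hpk]; omega⟩
      simp only [Finset.mem_filter, Finset.mem_Icc, id] at hb hmax
      refine ⟨b, ⟨hb.1.1, hb.1.2, hb.2⟩, fun i hbi hil => ?_⟩
      by_contra! hlt
      have := hmax i ⟨⟨by omega, hil⟩, hlt⟩
      omega
    have hcard : (S.card : ℝ) = (S.erase p).card + 1 := by
      rw [← Finset.card_erase_add_one hp]; push_cast; ring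
    have hpos : 0 ≤ 2 * lam * r ^ 2 := by positivity
    have hkb' := hCm k b hkb hbl
    have hfirst : StepChain F lam t (x k) (x b) ((1 + κ) * (C b - C k) + (θ + 2 * lam * r ^ 2)) := by
      rcases hkb.eq_or_lt with rfl | hlt
      · refine .refl _ ?_
        rw [sub_self]; positivity
      · have hd : ‖x k - x b‖ ≤ 2 * r := by
          rw [← dist_eq_norm]
          have := dist_triangle_right (x k) (x b) p
          linarith
        have hd2 : lam / 2 * ‖x k - x b‖ ^ 2 ≤ lam / 2 * (2 * r) ^ 2 :=
          mul_le_mul_of_nonneg_left (pow_le_pow_left₀ (norm_nonneg _) hd 2) (by positivity)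
        have h1 := hin k le_rfl (by omega)
        have h2 : 0 ≤ lam / 2 * ‖x k - x (k + 1)‖ ^ 2 := by positivity
        have h3 := hCm (k + 1) b hlt hbl
        have h4 : 0 ≤ κ * (C b - C k) := mul_nonneg hκ (by linarith)
        refine .single ?_
        linarith
    rcases hbl.eq_or_lt with rfl | hbl
    · refine hfirst.mono ?_
      have : 0 ≤ ((S.erase p).card : ℝ) * (2 * θ + 2 * lam * r ^ 2) := by positivity
      rw [hcard]
      linarith
    · have h1 := ih (l - (b + 1)) (by omega) (b + 1) (by omega) (S.erase p)
        (fun i hi => hin i (by omega)) (fun i hi hil hiS => hout i (by omega) hil fun q hq => by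
          by_cases hqp : q = p
          · exact hqp ▸ hmax i (by omega) hil.le
          · exact hiS q (Finset.mem_erase.2 ⟨hqp, hq⟩))
      refine ((hfirst.trans (.single (hin b hkb hbl))).trans h1).mono ?_
      rw [hcard]
      have h4 : 0 ≤ κ * (C (b + 1) - C b) := mul_nonneg hκ (by linarith [hC b hbl])
      linarith

/-- The residual is approximated by the energy drops towards suitable competitors, uniformly
under small perturbations of the time, of the penalization and of the point. -/
theorem exists_residual_le_uniform [FiniteDimensional ℝ X] (hF : EnergyAssumptions T F)
    (hT : 0 < T) (hlam : 0 < lam) (ht : t ∈ Icc 0 T) (R : ℝ) {θ : ℝ} (hθ : 0 < θ) :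
    ∃ δ > 0, ∀ t' ∈ Icc 0 T, |t' - t| < δ → ∀ s, |s - lam| < δ → ∀ x y : X, ‖x‖ ≤ R → ‖y‖ ≤ R →
      dist x y < δ → ∃ v, residual F lam t x ≤ F t' y - F t' v - s / 2 * ‖v - y‖ ^ 2 + θ := by
  have : ProperSpace X := FiniteDimensional.proper ℝ X
  obtain ⟨M, hM⟩ := (isCompact_closedBall (0 : X) R).exists_bound_of_continuousOn
    (hF.continuous ht).continuousOn
  -- Almost minimizing competitors have energy at most M + θ/2 and stay in a fixed ball, so uniform
  -- continuity on a compact set applies.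
  obtain ⟨R', -, hR'⟩ := hF.exists_norm_le hT (M + θ / 2)
  set K : Set (ℝ × ℝ × X × X) := Icc 0 T ×ˢ Icc (lam - 1) (lam + 1) ×ˢ
    Metric.closedBall 0 R ×ˢ Metric.closedBall 0 R' with hK
  have hKc : IsCompact K := isCompact_Icc.prod (isCompact_Icc.prod
    ((isCompact_closedBall _ _).prod (isCompact_closedBall _ _)))
  have hcont : ContinuousOn (fun p : ℝ × ℝ × X × X => F p.1 p.2.2.1 - F p.1 p.2.2.2 -
      p.2.1 / 2 * ‖p.2.2.2 - p.2.2.1‖ ^ 2) K := by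
    refine (ContinuousOn.sub ?_ ?_).sub (by fun_prop)
    · exact hF.continuousOn.comp (f := fun p : ℝ × ℝ × X × X => (p.1, p.2.2.1)) (by fun_prop)
        fun p hp => ⟨hp.1, mem_univ _⟩
    · exact hF.continuousOn.comp (f := fun p : ℝ × ℝ × X × X => (p.1, p.2.2.2)) (by fun_prop)
        fun p hp => ⟨hp.1, mem_univ _⟩
  obtain ⟨δ, hδ, huc⟩ := Metric.uniformContinuousOn_iff.1
    (hKc.uniformContinuousOn_of_continuous hcont) (θ / 2) (half_pos hθ)
  refine ⟨min δ 1, lt_min hδ one_pos, fun t' ht' htt s hs x y hx hy hxy => ?_⟩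
  have hδ1 := min_le_left δ 1
  have hs1 := abs_lt.1 (hs.trans_le (min_le_right δ 1))
  obtain ⟨v, hv⟩ := exists_residual_le (F := F) (lam := lam) (t := t) (half_pos hθ) x
  have hv' : ‖v‖ ≤ R' := by
    refine hR' t ht v ?_
    have h1 := residual_nonneg hF hT hlam ht x
    have h2 : 0 ≤ lam / 2 * ‖v - x‖ ^ 2 := by positivity
    have h3 := (le_abs_self _).trans (hM x (by simpa using hx))
    linarith
  refine ⟨v, ?_⟩
  have := huc (t, lam, x, v) ⟨ht, ⟨by linarith, by linarith⟩, by simpa using hx, by simpa using hv'⟩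
    (t', s, y, v) ⟨ht', ⟨by linarith, by linarith⟩, by simpa using hy, by simpa using hv'⟩ (by
      simp only [Prod.dist_eq, max_lt_iff, Real.dist_eq, dist_self]
      rw [abs_sub_comm t, abs_sub_comm lam]
      exact ⟨htt.trans_le hδ1, hs.trans_le hδ1, hxy.trans_le hδ1, hδ⟩)
  rw [Real.dist_eq, abs_lt] at this
  dsimp only at this
  linarith

namespace IsSchemeFamily

variable [FiniteDimensional ℝ X]

/-- Freezes time at `t` and the penalization at `lam`: half of θ pays for the residual, the other
half for replacing σ j by lam in the displacement, whose square is at most 4R². -/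
theorem exists_stepCost_bound (h : IsSchemeFamily T F u₀ lam σ τ U) (ht : t ∈ Icc 0 T)
    {θ : ℝ} (hθ : 0 < θ) :
    ∃ δ > 0, ∀ᶠ j in atTop, ∀ i, i + 1 ≤ ⌊T / τ j⌋₊ → |(i + 1 : ℕ) * τ j - t| < δ →
      lam / 2 * ‖U j i - U j (i + 1)‖ ^ 2 + residual F lam t (U j i) ≤
        stepCost F (τ j) (U j) i + θ := by
  obtain ⟨R, hR0, hR⟩ := h.exists_norm_le
  obtain ⟨δ, hδ, hres⟩ := exists_residual_le_uniform h.energy h.T_pos h.lam_pos ht R (half_pos hθ)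
  refine ⟨δ, hδ, ?_⟩
  filter_upwards [h.σ_tendsto.eventually (Metric.ball_mem_nhds lam hδ),
    h.σ_tendsto.eventually (Metric.ball_mem_nhds lam
      (show 0 < θ / (4 * R ^ 2) by positivity))] with j hj1 hj2 i hi hti
  obtain ⟨v, hv⟩ := hres _ (h.time_mem hi) hti (σ j) (by simpa [Real.dist_eq] using hj1) (U j i)
    (U j i) (hR j i (by omega)) (hR j i (by omega)) (by simpa using hδ)
  have h1 := h.le_stepCost hi v
  rw [norm_sub_rev] at h1
  have h2 : ‖U j i - U j (i + 1)‖ ≤ 2 * R := by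
    have := norm_sub_le (U j i) (U j (i + 1))
    linarith [hR j i (by omega), hR j (i + 1) hi]
  have h3 : ‖U j i - U j (i + 1)‖ ^ 2 ≤ 4 * R ^ 2 := by
    have := pow_le_pow_left₀ (norm_nonneg _) h2 2
    linarith
  have h4 : (lam - σ j) * ‖U j i - U j (i + 1)‖ ^ 2 ≤ θ := by
    rw [Real.dist_eq, abs_lt] at hj2
    calc (lam - σ j) * ‖U j i - U j (i + 1)‖ ^ 2
        ≤ θ / (4 * R ^ 2) * ‖U j i - U j (i + 1)‖ ^ 2 :=
          mul_le_mul_of_nonneg_right (by linarith) (by positivity)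
      _ ≤ θ / (4 * R ^ 2) * (4 * R ^ 2) := mul_le_mul_of_nonneg_left h3 (by positivity)
      _ = θ := by field_simp
  linarith

/-- The transition cost is asymptotically bounded by the accumulated energy drops of the scheme
along trajectories that connect the two end points in short time. -/
theorem exists_transitionCost_le (h : IsSchemeFamily T F u₀ lam σ τ U) (ht : t ∈ Icc 0 T)
    {a b : X} (hab : a ≠ b) (hb : IsStable F lam t b) {e : ℝ} (he : 0 < e) :
    ∃ δ > 0, ∀ᶠ j in atTop, ∀ k l, k ≤ l → l ≤ ⌊T / τ j⌋₊ →
      |k * τ j - t| < δ → |l * τ j - t| < δ →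
      (dist (U j k) a < δ ∧ IsStable F lam t a ∨ U j k = a) → dist (U j l) b < δ →
      transitionCost F lam t b a ≤ cumCost F (τ j) (U j) l - cumCost F (τ j) (U j) k + e := by
  have hlam := h.lam_pos
  obtain ⟨R, hR0, hR⟩ := h.exists_norm_le
  obtain ⟨C, hC⟩ := h.exists_cumCost_le
  have hC0 : 0 ≤ C := by simpa [cumCost] using hC 0 0 (Nat.zero_le _)
  obtain ⟨S, hS⟩ := exists_separation h.energy ht lam R
  set n : ℝ := (S.card : ℝ) with hn
  have hn0 : 0 ≤ n := Nat.cast_nonneg _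
  -- Six errors of size e/6: jumps inside balls, the relative error κ, the errors θ at balls, the
  -- link from `a`, and the displacement and residual of the link to `b`.
  obtain ⟨r, hr, hre, -, γ, hγ, δ₁, hδ₁, hout⟩ := hS (min 1 (e / (12 * lam * (n + 1))))
    (by positivity)
  have hr2 : n * (2 * lam * r ^ 2) ≤ e / 6 := by
    have h1 : r ^ 2 ≤ r := by
      have := hre.trans (min_le_left _ _)
      nlinarith
    have h2 := hre.trans (min_le_right _ _)
    rw [le_div_iff₀ (by positivity)] at h2
    have h3 : n * (2 * lam * r ^ 2) ≤ n * (2 * lam * r) := by gcongr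
    nlinarith [mul_pos hlam hr]
  set κ : ℝ := e / (6 * (C + 1)) with hκ
  have hκ0 : 0 < κ := by positivity
  have hκC : κ * C ≤ e / 6 := by
    rw [hκ, div_mul_eq_mul_div, div_le_div_iff₀ (by positivity) (by positivity)]
    nlinarith
  -- Outside the balls a step costs more than γ, so an error θ ≤ κγ is absorbed into a relative
  -- error κ.
  set θ : ℝ := min (κ * γ) (e / (12 * (n + 1))) with hθ
  have hθ0 : 0 < θ := by positivity
  have hnθ : n * (2 * θ) ≤ e / 6 := by
    have h2 : θ ≤ e / (12 * (n + 1)) := min_le_right _ _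
    rw [le_div_iff₀ (by positivity)] at h2
    nlinarith
  obtain ⟨δ₂, hδ₂, hstep⟩ := h.exists_stepCost_bound ht hθ0
  obtain ⟨δ₃, hδ₃, hend⟩ := exists_residual_le_uniform h.energy h.T_pos hlam ht (max R ‖b‖)
    (show 0 < e / 6 by positivity)
  set δ₄ : ℝ := min 1 (e / (3 * lam)) with hδ₄
  have hδ₄0 : 0 < δ₄ := by positivity
  have hquad : ∀ d : ℝ, 0 ≤ d → d < δ₄ → lam / 2 * d ^ 2 ≤ e / 6 := by
    intro d hd0 hd
    have h1 : d < 1 := hd.trans_le (min_le_left _ _)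
    have h2 : d < e / (3 * lam) := hd.trans_le (min_le_right _ _)
    rw [lt_div_iff₀ (by positivity)] at h2
    have h3 : d ^ 2 ≤ d := by nlinarith
    nlinarith
  refine ⟨min (min δ₁ δ₂) (min δ₃ δ₄), lt_min (lt_min hδ₁ hδ₂) (lt_min hδ₃ hδ₄0), ?_⟩
  filter_upwards [hstep, h.σ_tendsto.eventually (Metric.ball_mem_nhds lam hδ₁)]
    with j hj1 hj2 k l hkl hl hk hl' ha hbl
  simp only [lt_min_iff] at hk hl' ha hbl
  have hτ := h.τ_pos j
  have htime : ∀ i, k ≤ i → i < l → ∀ d, |k * τ j - t| < d → |l * τ j - t| < d →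
      |(i + 1 : ℕ) * τ j - t| < d := by
    intro i hki hil d h1 h2
    have h3 : (k : ℝ) * τ j ≤ (i + 1 : ℕ) * τ j :=
      mul_le_mul_of_nonneg_right (by exact_mod_cast (by omega)) hτ.le
    have h4 : ((i + 1 : ℕ) : ℝ) * τ j ≤ l * τ j :=
      mul_le_mul_of_nonneg_right (by exact_mod_cast hil) hτ.le
    rw [abs_lt] at h1 h2 ⊢
    constructor <;> linarith
  have hdiff : ∀ i, cumCost F (τ j) (U j) (i + 1) - cumCost F (τ j) (U j) i =
      stepCost F (τ j) (U j) i := fun i => by rw [cumCost_succ]; ring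
  have hin : ∀ i, k ≤ i → i < l →
      lam / 2 * ‖U j i - U j (i + 1)‖ ^ 2 + residual F lam t (U j i) ≤
        cumCost F (τ j) (U j) (i + 1) - cumCost F (τ j) (U j) i + θ := fun i hki hil => by
    rw [hdiff]
    exact hj1 i (by omega) (htime i hki hil _ hk.1.2 hl'.1.2)
  have hmid := stepChain_of_balls (F := F) (t := t) hlam (x := U j) (C := cumCost F (τ j) (U j))
    (r := r) hθ0.le hκ0.le (fun i hi => h.cumCost_mono (Nat.le_succ i) (by omega)) (l - k) k
    (by omega) S hin (fun i hki hil hiS => by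
      refine (hin i hki hil).trans ?_
      obtain ⟨v, hv⟩ := hout _ (h.time_mem (show i + 1 ≤ _ by omega))
        (htime i hki hil _ hk.1.1 hl'.1.1) (σ j) (by simpa [Real.dist_eq] using hj2) (U j i)
        (hR j i (by omega)) hiS
      have h1 := h.le_stepCost (show i + 1 ≤ ⌊T / τ j⌋₊ by omega) v
      have h2 : 0 ≤ σ j / 2 * ‖U j (i + 1) - U j i‖ ^ 2 := by
        have := h.σ_pos j
        positivity
      have h3 : κ * γ ≤ κ * stepCost F (τ j) (U j) i :=
        mul_le_mul_of_nonneg_left (by linarith) hκ0.le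
      have h4 : θ ≤ κ * γ := min_le_left _ _
      rw [hdiff]
      linarith)
  -- Linking from `a` pays the residual of `a`, hence the need for stability; the alternative `U j k
  -- = a` covers a possibly unstable initial point.
  have hfirst : StepChain F lam t a (U j k) (e / 6) := by
    rcases ha with ⟨ha, has⟩ | ha
    · refine .single ?_
      rw [has.residual_eq_zero h.energy h.T_pos hlam ht, add_zero, ← dist_eq_norm, dist_comm]
      exact hquad _ dist_nonneg ha.2.2
    · rw [ha]
      exact .refl _ (by positivity)
  have hlast : StepChain F lam t (U j l) b (e / 6 + e / 6) := by
    refine .single (add_le_add ?_ ?_)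
    · rw [← dist_eq_norm]
      exact hquad _ dist_nonneg hbl.2.2
    -- The residual at `U j l` is small by comparison with the stable point `b`.
    · obtain ⟨v, hv⟩ := hend t ht (by simpa using hδ₃) lam (by simpa using hδ₃) (U j l) b
        ((hR j l hl).trans (le_max_left _ _)) (le_max_right _ _) hbl.2.1
      have := hb v
      linarith
  have hfin := transitionCost_le_of_stepChain h.energy h.T_pos hlam ht hab
    ((hfirst.trans hmid).trans hlast)
  rw [hb.residual_eq_zero h.energy h.T_pos hlam ht] at hfin
  have h1 : κ * (cumCost F (τ j) (U j) l - cumCost F (τ j) (U j) k) ≤ κ * C := by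
    refine mul_le_mul_of_nonneg_left ?_ hκ0.le
    have h2 := h.cumCost_mono (Nat.zero_le k) (hkl.trans hl)
    have h3 : cumCost F (τ j) (U j) 0 = 0 := by simp [cumCost]
    linarith [hC j l hl]
  linarith

end IsSchemeFamily

/-! ### Passage to the limit: regularity, stability and the energy identity. -/

/-- The index of the discrete solution that the interpolant attains at time `t`. -/
noncomputable def schemeIndex (T c t : ℝ) : ℕ :=
  min ⌈t / c⌉₊ ⌊T / c⌋₊

theorem schemeIndex_le (T c t : ℝ) : schemeIndex T c t ≤ ⌊T / c⌋₊ :=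
  min_le_right _ _

theorem schemeIndex_zero (T c : ℝ) : schemeIndex T c 0 = 0 := by
  simp [schemeIndex]

theorem schemeIndex_mono {T c : ℝ} (hc : 0 < c) : Monotone (schemeIndex T c) := fun _ _ hst =>
  min_le_min_right _ (Nat.ceil_le_ceil (div_le_div_of_nonneg_right hst hc.le))

theorem schemeIndex_sub_le {T c s t : ℝ} (hc : 0 < c) (hst : s ≤ t) :
    (schemeIndex T c t : ℝ) * c - schemeIndex T c s * c ≤ t - s + c := by
  have h1 : ⌈t / c⌉₊ ≤ ⌈(t - s) / c⌉₊ + ⌈s / c⌉₊ := by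
    refine le_trans (le_of_eq ?_) (Nat.ceil_add_le _ _)
    rw [← add_div, sub_add_cancel]
  have h2 : schemeIndex T c t ≤ ⌈(t - s) / c⌉₊ + schemeIndex T c s := by
    unfold schemeIndex
    omega
  have h3 : (⌈(t - s) / c⌉₊ : ℝ) < (t - s) / c + 1 :=
    Nat.ceil_lt_add_one (div_nonneg (sub_nonneg.2 hst) hc.le)
  have h4 : (schemeIndex T c t : ℝ) ≤ ⌈(t - s) / c⌉₊ + schemeIndex T c s := by exact_mod_cast h2
  have h5 : (schemeIndex T c t : ℝ) - schemeIndex T c s ≤ (t - s) / c + 1 := by linarith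
  have h6 := mul_le_mul_of_nonneg_right h5 hc.le
  rw [add_mul, div_mul_cancel₀ _ hc.ne'] at h6
  linarith

theorem abs_schemeIndex_sub_le {T c t : ℝ} (hc : 0 < c) (ht : t ∈ Icc 0 T) :
    |(schemeIndex T c t : ℝ) * c - t| ≤ c := by
  have h1 : t / c ≤ ⌈t / c⌉₊ := Nat.le_ceil _
  have h2 : (⌈t / c⌉₊ : ℝ) < t / c + 1 := Nat.ceil_lt_add_one (div_nonneg ht.1 hc.le)
  have h3 : T / c < ⌊T / c⌋₊ + 1 := Nat.lt_floor_add_one _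
  have h4 : t / c ≤ T / c := div_le_div_of_nonneg_right ht.2 hc.le
  have h5 : |(schemeIndex T c t : ℝ) - t / c| ≤ 1 := by
    unfold schemeIndex
    rw [Nat.cast_min, abs_le]
    refine ⟨?_, ?_⟩
    · have := le_min (show t / c - 1 ≤ (⌈t / c⌉₊ : ℝ) by linarith)
        (show t / c - 1 ≤ (⌊T / c⌋₊ : ℝ) by linarith)
      linarith
    · have := min_le_left (⌈t / c⌉₊ : ℝ) (⌊T / c⌋₊ : ℝ)
      linarith
  have h6 : (schemeIndex T c t : ℝ) * c - t = (schemeIndex T c t - t / c) * c := by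
    field_simp
  rw [h6, abs_mul, abs_of_pos hc]
  nlinarith

theorem abs_floor_sub_le {c r : ℝ} (hc : 0 < c) (hr : 0 ≤ r) :
    |(⌊r / c⌋₊ : ℝ) * c - r| ≤ c := by
  have h1 := Nat.floor_le (div_nonneg hr hc.le)
  have h2 := Nat.lt_floor_add_one (r / c)
  rw [le_div_iff₀ hc] at h1
  rw [div_lt_iff₀ hc] at h2
  rw [abs_le]
  constructor <;> linarith

/-- The interpolants of a family of schemes converge pointwise to `u`, and their accumulated energy
drops converge pointwise to `W`. -/
structure IsSchemeLimit (T : ℝ) (F : ℝ → X → ℝ) (u₀ : X) (lam : ℝ) (σ τ : ℕ → ℝ)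
    (U : ℕ → ℕ → X) (u : ℝ → X) (W : ℝ → ℝ) : Prop where
  family : IsSchemeFamily T F u₀ lam σ τ U
  tendsto_cost : ∀ t,
    Tendsto (fun j => cumCost F (τ j) (U j) (schemeIndex T (τ j) t)) atTop (𝓝 (W t))
  tendsto : ∀ t, Tendsto (fun j => U j (schemeIndex T (τ j) t)) atTop (𝓝 (u t))

theorem IsSchemeFamily.exists_oscillation_interpolant [FiniteDimensional ℝ X]
    (h : IsSchemeFamily T F u₀ lam σ τ U) {η : ℝ} (hη : 0 < η) :
    ∃ c > 0, ∃ δ > 0, ∀ᶠ j in atTop, ∀ s t, s ≤ t → t - s ≤ δ →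
      cumCost F (τ j) (U j) (schemeIndex T (τ j) t) -
        cumCost F (τ j) (U j) (schemeIndex T (τ j) s) < c →
      dist (U j (schemeIndex T (τ j) s)) (U j (schemeIndex T (τ j) t)) < η := by
  obtain ⟨c, hc, δ, hδ, hj⟩ := h.exists_oscillation hη
  refine ⟨c, hc, δ / 2, half_pos hδ, ?_⟩
  filter_upwards [hj, h.τ_tendsto.eventually (gt_mem_nhds (half_pos hδ))] with j hj hτ s t hst hd
  have h1 := schemeIndex_sub_le (T := T) (h.τ_pos j) hst
  exact hj _ _ (schemeIndex_mono (h.τ_pos j) hst) (schemeIndex_le _ _ _) (by linarith)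

theorem IsSchemeFamily.exists_limit [FiniteDimensional ℝ X]
    (h : IsSchemeFamily T F u₀ lam σ τ U) :
    ∃ φ : ℕ → ℕ, StrictMono φ ∧ ∃ (u : ℝ → X) (W : ℝ → ℝ),
      IsSchemeLimit T F u₀ lam (σ ∘ φ) (τ ∘ φ) (U ∘ φ) u W := by
  have : ProperSpace X := FiniteDimensional.proper ℝ X
  obtain ⟨R, -, hR⟩ := h.exists_norm_le
  obtain ⟨C, hC⟩ := h.exists_cumCost_le
  obtain ⟨φ, hφ, u, W, -, hW, hu⟩ := exists_subseq_tendsto_of_oscillation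
    (isCompact_closedBall (0 : X) R) (fun j t => U j (schemeIndex T (τ j) t))
    (fun j t => cumCost F (τ j) (U j) (schemeIndex T (τ j) t)) (C := C)
    (fun j t => by simpa using hR j _ (schemeIndex_le _ _ _))
    (fun j s t hst => h.cumCost_mono (schemeIndex_mono (h.τ_pos j) hst) (schemeIndex_le _ _ _))
    (fun j t => ⟨by simpa [cumCost] using h.cumCost_mono (Nat.zero_le _) (schemeIndex_le T (τ j) t),
      hC j _ (schemeIndex_le _ _ _)⟩)
    (fun η hη => h.exists_oscillation_interpolant hη)
  exact ⟨φ, hφ, u, W, h.comp hφ, hW, hu⟩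

namespace IsSchemeLimit

variable {u : ℝ → X} {W : ℝ → ℝ}

theorem monotone (h : IsSchemeLimit T F u₀ lam σ τ U u W) : Monotone W := fun s t hst =>
  le_of_tendsto_of_tendsto' (h.tendsto_cost s) (h.tendsto_cost t) fun j =>
    h.family.cumCost_mono (schemeIndex_mono (h.family.τ_pos j) hst) (schemeIndex_le _ _ _)

theorem tendsto_time (h : IsSchemeLimit T F u₀ lam σ τ U u W) (ht : t ∈ Icc 0 T) :
    Tendsto (fun j => (schemeIndex T (τ j) t : ℝ) * τ j) atTop (𝓝 t) := by
  rw [tendsto_iff_dist_tendsto_zero]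
  exact squeeze_zero (fun _ => dist_nonneg)
    (fun j => abs_schemeIndex_sub_le (h.family.τ_pos j) ht) h.family.τ_tendsto

theorem apply_zero (h : IsSchemeLimit T F u₀ lam σ τ U u W) : u 0 = u₀ := by
  refine tendsto_nhds_unique (h.tendsto 0) ?_
  simp [schemeIndex_zero, h.family.start]

theorem stronglyMeasurable (h : IsSchemeLimit T F u₀ lam σ τ U u W) :
    MeasureTheory.StronglyMeasurable u := by
  refine stronglyMeasurable_of_tendsto atTop (f := fun j t => U j (schemeIndex T (τ j) t))
    (fun j => ?_) (tendsto_pi_nhds.2 h.tendsto)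
  exact (MeasureTheory.StronglyMeasurable.of_discrete
    (f := fun n => U j (min n ⌊T / τ j⌋₊))).comp_measurable
    (Nat.measurable_ceil.comp (measurable_id.div_const (τ j)))

variable [FiniteDimensional ℝ X]

theorem oscillation (h : IsSchemeLimit T F u₀ lam σ τ U u W) {η : ℝ} (hη : 0 < η) :
    ∃ c > 0, ∃ δ > 0, ∀ s t, s ≤ t → t - s ≤ δ → W t - W s < c → dist (u s) (u t) ≤ η := by
  obtain ⟨c, hc, δ, hδ, hj⟩ := h.family.exists_oscillation_interpolant hη
  refine ⟨c, hc, δ, hδ, fun s t hst hd hW => ?_⟩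
  refine le_of_tendsto ((h.tendsto s).dist (h.tendsto t)) ?_
  filter_upwards [hj, ((h.tendsto_cost t).sub (h.tendsto_cost s)).eventually (gt_mem_nhds hW)]
    with j hj hj' using (hj s t hst hd hj').le

theorem exists_norm_le (h : IsSchemeLimit T F u₀ lam σ τ U u W) : ∃ R, ∀ t, ‖u t‖ ≤ R := by
  obtain ⟨R, -, hR⟩ := h.family.exists_norm_le
  exact ⟨R, fun t => le_of_tendsto' (h.tendsto t).norm fun j => hR j _ (schemeIndex_le _ _ _)⟩

/-- At continuity times of the dissipation, the discrete solutions converge along all indices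
whose times converge. -/
theorem tendsto_of_continuousAt (h : IsSchemeLimit T F u₀ lam σ τ U u W) (ht : t ∈ Ioo 0 T)
    (hW : ContinuousAt W t) {k : ℕ → ℕ} (hk : ∀ᶠ j in atTop, k j ≤ ⌊T / τ j⌋₊)
    (hkt : Tendsto (fun j => (k j : ℝ) * τ j) atTop (𝓝 t)) :
    Tendsto (fun j => U j (k j)) atTop (𝓝 (u t)) := by
  rw [Metric.tendsto_nhds]
  intro η hη
  obtain ⟨c, hc, δ, hδ, hj⟩ := h.family.exists_oscillation (half_pos hη)
  -- Both `k j` and the interpolant's index at t lie between the indices at q and q', where the cost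
  -- varies by less than c.
  obtain ⟨q, q', h1, h2, h3, h4, h5, h6⟩ := exists_rat_sandwich hW (half_pos hc)
    (show 0 < min (δ / 4) (min t (T - t)) by
      have := ht.1
      have := sub_pos.2 ht.2
      positivity)
  simp only [lt_min_iff] at h3 h4
  rw [abs_lt] at h5 h6
  have hq : (q : ℝ) ∈ Icc 0 T := ⟨by linarith, by linarith⟩
  have hq' : (q' : ℝ) ∈ Icc 0 T := ⟨by linarith, by linarith⟩
  filter_upwards [hj, hk, (h.tendsto t).eventually (Metric.ball_mem_nhds _ (half_pos hη)),
    (h.tendsto_time hq).eventually_lt hkt h1, hkt.eventually_lt (h.tendsto_time hq') h2,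
    ((h.tendsto_cost q').sub (h.tendsto_cost q)).eventually
      (gt_mem_nhds (show W q' - W q < c by linarith)),
    h.family.τ_tendsto.eventually (gt_mem_nhds (half_pos hδ))] with j hj hk ht hkq hkq' hcost hτ
  have hτ0 := h.family.τ_pos j
  have hkq := Nat.cast_lt.1 (lt_of_mul_lt_mul_right hkq hτ0.le)
  have hkq' := Nat.cast_lt.1 (lt_of_mul_lt_mul_right hkq' hτ0.le)
  have hiq := schemeIndex_mono (T := T) hτ0 h1.le
  have hiq' := schemeIndex_mono (T := T) hτ0 h2.le
  have hqq := schemeIndex_sub_le (T := T) hτ0 (h1.trans h2).le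
  have key : ∀ a b, schemeIndex T (τ j) q ≤ a → a ≤ b → b ≤ schemeIndex T (τ j) q' →
      dist (U j a) (U j b) < η / 2 := by
    intro a b ha hab hb
    have hbm := hb.trans (schemeIndex_le _ _ _)
    refine hj a b hab hbm ?_ ?_
    · have e1 : (schemeIndex T (τ j) q : ℝ) * τ j ≤ a * τ j :=
        mul_le_mul_of_nonneg_right (by exact_mod_cast ha) hτ0.le
      have e2 : (b : ℝ) * τ j ≤ schemeIndex T (τ j) q' * τ j :=
        mul_le_mul_of_nonneg_right (by exact_mod_cast hb) hτ0.le
      linarith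
    · have e1 := h.family.cumCost_mono ha (hab.trans hbm)
      have e2 := h.family.cumCost_mono hb (schemeIndex_le T (τ j) q')
      linarith
  have hd : dist (U j (k j)) (U j (schemeIndex T (τ j) t)) < η / 2 := by
    rcases le_total (k j) (schemeIndex T (τ j) t) with hle | hle
    · exact key _ _ hkq.le hle hiq'
    · rw [dist_comm]
      exact key _ _ hiq hle hkq'.le
  have := dist_triangle (U j (k j)) (U j (schemeIndex T (τ j) t)) (u t)
  linarith

/-- The iterate and its predecessor converge to the same point, so minimality penalized around the
predecessor becomes stability. -/
theorem isStable_of_continuousAt (h : IsSchemeLimit T F u₀ lam σ τ U u W) (ht : t ∈ Ioo 0 T)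
    (hW : ContinuousAt W t) : IsStable F lam t (u t) := by
  have htI := Ioo_subset_Icc_self ht
  have hpos : ∀ᶠ j in atTop, 1 ≤ schemeIndex T (τ j) t := by
    filter_upwards [(h.tendsto_time htI).eventually (lt_mem_nhds ht.1)] with j hj
    by_contra hcon
    have : schemeIndex T (τ j) t = 0 := by omega
    simp [this] at hj
  have hprev : Tendsto (fun j => ((schemeIndex T (τ j) t - 1 : ℕ) : ℝ) * τ j) atTop (𝓝 t) := by
    have h1 := (h.tendsto_time htI).sub h.family.τ_tendsto
    rw [sub_zero] at h1
    refine h1.congr' ?_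
    filter_upwards [hpos] with j hj
    push_cast [Nat.cast_sub hj]
    ring
  have hprev' := h.tendsto_of_continuousAt ht hW
    (Eventually.of_forall fun j => (Nat.sub_le _ 1).trans (schemeIndex_le T (τ j) t)) hprev
  refine isStable_of_tendsto h.family.energy (Eventually.of_forall fun j =>
    h.family.time_mem (schemeIndex_le T (τ j) t)) htI (h.tendsto_time htI) h.family.σ_tendsto
    (h.tendsto t) hprev' ?_
  filter_upwards [hpos] with j hj v
  obtain ⟨n, hn⟩ : ∃ n, schemeIndex T (τ j) t = n + 1 := ⟨_, (Nat.sub_add_cancel hj).symm⟩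
  have h1 := h.family.step j n (hn ▸ schemeIndex_le T (τ j) t) v
  rw [hn, Nat.add_sub_cancel]
  have : 0 ≤ σ j / 2 * ‖U j (n + 1) - U j n‖ ^ 2 := by
    have := h.family.σ_pos j
    positivity
  linarith

theorem intervalIntegrable (h : IsSchemeLimit T F u₀ lam σ τ U u W) {a b : ℝ} (ha : a ∈ Icc 0 T)
    (hb : b ∈ Icc 0 T) :
    IntervalIntegrable (fun r => timeDeriv T F r (u r)) MeasureTheory.volume a b := by
  obtain ⟨R, hR⟩ := h.exists_norm_le
  obtain ⟨C, -, hC⟩ := h.family.energy.exists_abs_timeDeriv_le h.family.T_pos R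
  exact intervalIntegrable_timeDeriv_comp h.family.energy h.family.T_pos
    h.stronglyMeasurable.aestronglyMeasurable (fun r hr => hC r hr _ (hR r)) ha hb

/-- The floor index is not the interpolant's index, but outside the countably many discontinuities
of W both give the same limit; dominated convergence concludes. -/
theorem tendsto_integral (h : IsSchemeLimit T F u₀ lam σ τ U u W) (ht : t ∈ Icc 0 T) :
    Tendsto (fun j => ∫ r in (0 : ℝ)..t, timeDeriv T F r (U j ⌊r / τ j⌋₊)) atTop
      (𝓝 (∫ r in (0 : ℝ)..t, timeDeriv T F r (u r))) := by
  have h0 : (0 : ℝ) ∈ Icc 0 T := left_mem_Icc.2 h.family.T_pos.le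
  obtain ⟨R, -, hR⟩ := h.family.exists_norm_le
  obtain ⟨C, -, hC⟩ := h.family.energy.exists_abs_timeDeriv_le h.family.T_pos R
  refine intervalIntegral.tendsto_integral_filter_of_dominated_convergence (fun _ => C)
    (Eventually.of_forall fun j => ?_) (Eventually.of_forall fun j => ?_)
    intervalIntegrable_const ?_
  · rw [uIoc_of_le ht.1]
    exact (intervalIntegrable_iff_integrableOn_Ioc_of_le ht.1).1
      (h.family.intervalIntegrable_floor j h0 ht) |>.aestronglyMeasurable
  · filter_upwards with r hr
    rw [uIoc_of_le ht.1] at hr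
    have hr' : r ∈ Icc 0 T := ⟨hr.1.le, hr.2.trans ht.2⟩
    exact hC r hr' _ (hR j _ (h.family.floor_le j hr'))
  · filter_upwards [h.monotone.countable_not_continuousAt.ae_notMem MeasureTheory.volume,
      MeasureTheory.Measure.ae_ne MeasureTheory.volume T] with r hr1 hr2 hr
    rw [uIoc_of_le ht.1] at hr
    have hr' : r ∈ Ioo 0 T := ⟨hr.1, lt_of_le_of_ne (hr.2.trans ht.2) hr2⟩
    have hrI := Ioo_subset_Icc_self hr'
    have hlim := h.tendsto_of_continuousAt hr' (not_not.1 hr1)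
      (k := fun j => ⌊r / τ j⌋₊) (Eventually.of_forall fun j => h.family.floor_le j hrI) (by
        rw [tendsto_iff_dist_tendsto_zero]
        exact squeeze_zero (fun _ => dist_nonneg)
          (fun j => abs_floor_sub_le (h.family.τ_pos j) hr.1.le) h.family.τ_tendsto)
    exact ((h.family.energy.continuousOn_timeDeriv h.family.T_pos (r, u r)
      ⟨hrI, mem_univ _⟩).tendsto.comp (tendsto_nhdsWithin_iff.2
        ⟨tendsto_const_nhds.prodMk_nhds hlim, Eventually.of_forall fun _ => ⟨hrI, mem_univ _⟩⟩))

/-- The energy identity in the limit. -/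
theorem cost_eq (h : IsSchemeLimit T F u₀ lam σ τ U u W) (ht : t ∈ Icc 0 T) :
    W t = F 0 u₀ - F t (u t) + ∫ r in (0 : ℝ)..t, timeDeriv T F r (u r) := by
  have h0 : (0 : ℝ) ∈ Icc 0 T := left_mem_Icc.2 h.family.T_pos.le
  obtain ⟨R, -, hR⟩ := h.family.exists_norm_le
  obtain ⟨C, hC0, hC⟩ := h.family.energy.exists_abs_timeDeriv_le h.family.T_pos R
  refine tendsto_nhds_unique (h.tendsto_cost t) ?_
  have hmem := fun j => h.family.time_mem (schemeIndex_le T (τ j) t)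
  have hF : Tendsto (fun j => F (schemeIndex T (τ j) t * τ j) (U j (schemeIndex T (τ j) t))) atTop
      (𝓝 (F t (u t))) :=
    ((h.family.energy.continuousOn (t, u t) ⟨ht, mem_univ _⟩).tendsto.comp
      (tendsto_nhdsWithin_iff.2 ⟨(h.tendsto_time ht).prodMk_nhds (h.tendsto t),
        Eventually.of_forall fun j => ⟨hmem j, mem_univ _⟩⟩))
  -- The discrete identity ends at a node, which is within τ j of t.
  have hrest : Tendsto (fun j => ∫ r in t..schemeIndex T (τ j) t * τ j,
      timeDeriv T F r (U j ⌊r / τ j⌋₊)) atTop (𝓝 0) := by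
    refine squeeze_zero_norm (a := fun j => C * τ j) (fun j => ?_)
      (by simpa using h.family.τ_tendsto.const_mul C)
    refine (intervalIntegral.norm_integral_le_of_norm_le_const (C := C) fun r hr => ?_).trans
      (mul_le_mul_of_nonneg_left (abs_schemeIndex_sub_le (h.family.τ_pos j) ht) hC0.le)
    have hr' : r ∈ Icc 0 T := uIcc_subset_Icc ht (hmem j) (uIoc_subset_uIcc hr)
    exact hC r hr' _ (hR j _ (h.family.floor_le j hr'))
  have hsum := (hF.const_sub (F 0 u₀)).add ((h.tendsto_integral ht).add hrest)
  rw [add_zero] at hsum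
  refine hsum.congr fun j => ?_
  rw [h.family.cumCost_eq (schemeIndex_le T (τ j) t),
    intervalIntegral.integral_add_adjacent_intervals (h.family.intervalIntegrable_floor j h0 ht)
      (h.family.intervalIntegrable_floor j ht (hmem j))]

theorem cost_zero (h : IsSchemeLimit T F u₀ lam σ τ U u W) : W 0 = 0 := by
  have := h.cost_eq (left_mem_Icc.2 h.family.T_pos.le)
  simpa [h.apply_zero] using this

theorem exists_left_limit (h : IsSchemeLimit T F u₀ lam σ τ U u W) (t : ℝ) :
    ∃ y, Tendsto u (𝓝[<] t) (𝓝 y) :=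
  exists_tendsto_of_oscillation (fun _ hη => h.oscillation hη) nhdsWithin_le_nhds
    (h.monotone.tendsto_nhdsLT t)

theorem exists_right_limit (h : IsSchemeLimit T F u₀ lam σ τ U u W) (t : ℝ) :
    ∃ y, Tendsto u (𝓝[>] t) (𝓝 y) :=
  exists_tendsto_of_oscillation (fun _ hη => h.oscillation hη) nhdsWithin_le_nhds
    (h.monotone.tendsto_nhdsGT t)

theorem exists_isRegulatedWith (h : IsSchemeLimit T F u₀ lam σ τ U u W) :
    ∃ uₗ uᵣ, IsRegulatedWith T u uₗ uᵣ := by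
  choose L hL using h.exists_left_limit
  choose R hR using h.exists_right_limit
  have hT := h.family.T_pos
  refine ⟨Function.update L 0 (u 0), Function.update R T (L T), ⟨?_, ?_, ?_, ?_⟩⟩
  · intro t ht
    rw [Function.update_of_ne ht.1.ne']
    exact hL t
  · intro t ht
    rw [Function.update_of_ne ht.2.ne]
    exact hR t
  · simp
  · simp [hT.ne']

/-- Continuity times of W are dense and carry stable values; restricting `l` to them, closedness of
stability applies. -/
theorem isStable_of_frequently (h : IsSchemeLimit T F u₀ lam σ τ U u W) (ht : t ∈ Icc 0 T)
    {l : Filter ℝ} {p : X} (hl : l ≤ 𝓝 t) (hfr : ∃ᶠ r in l, r ∈ Ioo 0 T ∧ ContinuousAt W r)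
    (hp : Tendsto u l (𝓝 p)) : IsStable F lam t p := by
  have : (l ⊓ 𝓟 {r | r ∈ Ioo 0 T ∧ ContinuousAt W r}).NeBot :=
    frequently_mem_iff_neBot.1 hfr
  have hev : ∀ᶠ r in l ⊓ 𝓟 {r | r ∈ Ioo 0 T ∧ ContinuousAt W r},
      r ∈ Ioo 0 T ∧ ContinuousAt W r := mem_inf_of_right (mem_principal_self _)
  exact isStable_of_tendsto h.family.energy (s := id) (σ := fun _ => lam)
    (hev.mono fun r hr => Ioo_subset_Icc_self hr.1) ht (tendsto_id'.2 (inf_le_left.trans hl))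
    tendsto_const_nhds (hp.mono_left inf_le_left) (hp.mono_left inf_le_left)
    (hev.mono fun r hr => h.isStable_of_continuousAt hr.1 hr.2)

theorem exists_continuousAt (h : IsSchemeLimit T F u₀ lam σ τ U u W) {a b : ℝ} (hab : a < b) :
    ∃ r ∈ Ioo a b, ContinuousAt W r := by
  obtain ⟨r, hr, hr'⟩ := (h.monotone.countable_not_continuousAt.dense_compl ℝ).exists_between hab
  exact ⟨r, hr', not_not.1 hr⟩

theorem isStable_left (h : IsSchemeLimit T F u₀ lam σ τ U u W) (ht : t ∈ Ioc 0 T) {p : X}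
    (hp : Tendsto u (𝓝[<] t) (𝓝 p)) : IsStable F lam t p := by
  refine h.isStable_of_frequently ⟨ht.1.le, ht.2⟩ nhdsWithin_le_nhds ?_ hp
  refine (nhdsLT_basis t).frequently_iff.2 fun a ha => ?_
  obtain ⟨r, hr, hr'⟩ := h.exists_continuousAt (max_lt ha ht.1)
  exact ⟨r, ⟨(le_max_left _ _).trans_lt hr.1, hr.2⟩,
    ⟨(le_max_right _ _).trans_lt hr.1, hr.2.trans_le ht.2⟩, hr'⟩

theorem isStable_right (h : IsSchemeLimit T F u₀ lam σ τ U u W) (ht : t ∈ Ico 0 T) {p : X}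
    (hp : Tendsto u (𝓝[>] t) (𝓝 p)) : IsStable F lam t p := by
  refine h.isStable_of_frequently ⟨ht.1, ht.2.le⟩ nhdsWithin_le_nhds ?_ hp
  refine (nhdsGT_basis t).frequently_iff.2 fun a ha => ?_
  obtain ⟨r, hr, hr'⟩ := h.exists_continuousAt (lt_min ha ht.2)
  exact ⟨r, ⟨hr.1, hr.2.trans_le (min_le_left _ _)⟩,
    ⟨ht.1.trans_lt hr.1, hr.2.trans_le (min_le_right _ _)⟩, hr'⟩

/-- The transition cost is bounded by the dissipation of the limit across the transition. -/
theorem transitionCost_le (h : IsSchemeLimit T F u₀ lam σ τ U u W) (ht : t ∈ Icc 0 T) {a b : X}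
    (hab : a ≠ b) (hb : IsStable F lam t b) {A B : ℝ}
    (hA : ∀ e > 0, ∃ y ∈ Icc 0 T, y ≤ t ∧ t - y < e ∧ A - e < W y ∧
      (dist (u y) a < e ∧ IsStable F lam t a ∨ ∀ j, U j (schemeIndex T (τ j) y) = a))
    (hB : ∀ e > 0, ∃ z ∈ Icc 0 T, t ≤ z ∧ z - t < e ∧ W z < B + e ∧ dist (u z) b < e) :
    transitionCost F lam t b a ≤ B - A := by
  refine le_of_forall_pos_le_add fun e he => ?_
  obtain ⟨δ, hδ, hj⟩ := h.family.exists_transitionCost_le ht hab hb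
    (show 0 < e / 3 by positivity)
  have hm : 0 < min δ (e / 3) := by positivity
  obtain ⟨y, hy, hyt, hyd, hyW, hya⟩ := hA _ hm
  obtain ⟨z, hz, hzt, hzd, hzW, hzb⟩ := hB _ hm
  have hm1 := min_le_left δ (e / 3)
  have hm2 := min_le_right δ (e / 3)
  have hlim : transitionCost F lam t b a ≤ W z - W y + e / 3 := by
    refine ge_of_tendsto (((h.tendsto_cost z).sub (h.tendsto_cost y)).add_const (e / 3)) ?_
    have hy1 := (h.tendsto_time hy).eventually
      (Metric.ball_mem_nhds y (show 0 < δ - (t - y) by linarith))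
    have hz1 := (h.tendsto_time hz).eventually
      (Metric.ball_mem_nhds z (show 0 < δ - (z - t) by linarith))
    have hz2 := ((h.tendsto z).dist (tendsto_const_nhds (x := b))).eventually
      (gt_mem_nhds (hzb.trans_le hm1))
    have hy2 : ∀ᶠ j in atTop, dist (U j (schemeIndex T (τ j) y)) a < δ ∧ IsStable F lam t a ∨
        U j (schemeIndex T (τ j) y) = a := by
      rcases hya with ⟨hya, has⟩ | hya
      · filter_upwards [((h.tendsto y).dist (tendsto_const_nhds (x := a))).eventually
          (gt_mem_nhds (hya.trans_le hm1))] with j hj using Or.inl ⟨hj, has⟩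
      · exact Eventually.of_forall fun j => Or.inr (hya j)
    filter_upwards [hj, hy1, hz1, hy2, hz2] with j hj hy1 hz1 hy2 hz2
    rw [Real.dist_eq, abs_lt] at hy1 hz1
    exact hj _ _ (schemeIndex_mono (h.family.τ_pos j) (hyt.trans hzt)) (schemeIndex_le _ _ _)
      (abs_lt.2 ⟨by linarith, by linarith⟩) (abs_lt.2 ⟨by linarith, by linarith⟩) hy2 hz2
  linarith

end IsSchemeLimit

/-! ### The energy balance. -/

/-- Near a critical point, the energy drops less than any multiple of the norm of the gradient. -/
theorem eventually_energy_ge (hF : EnergyAssumptions T F) (ht : t ∈ Icc 0 T) {u : X}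
    (hu : u ∈ criticalSet F t) {e : ℝ} (he : 0 < e) :
    ∀ᶠ v in 𝓝 u, F t u - e * ‖gradient (F t) v‖ ≤ F t v := by
  obtain ⟨r, hr, hiso⟩ := hF.F3 t ht u hu
  have h1 : ((-e : ℝ) : EReal) <
      liminf (fun v => (((F t v - F t u) / ‖gradient (F t) v‖ : ℝ) : EReal)) (𝓝[≠] u) :=
    lt_of_lt_of_le (by exact_mod_cast neg_neg_of_pos he) (hF.F4 t ht u hu)
  have h2 := eventually_nhdsWithin_iff.1 (eventually_lt_of_lt_liminf h1)
  filter_upwards [h2, Metric.ball_mem_nhds u hr] with v hv hvr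
  rcases eq_or_ne v u with rfl | hne
  · have := mul_nonneg he.le (norm_nonneg (gradient (F t) v))
    linarith
  -- (F3) excludes other critical points near `u`, so the quotient in (F4) is a genuine one.
  · have hpos : 0 < ‖gradient (F t) v‖ :=
      norm_pos_iff.2 fun h0 => hne (hiso v h0 hvr)
    have h3 : -e < (F t v - F t u) / ‖gradient (F t) v‖ := by exact_mod_cast hv hne
    rw [lt_div_iff₀ hpos] at h3
    linarith

theorem transitionCost_nonneg (hF : EnergyAssumptions T F) (hT : 0 < T) (hlam : 0 < lam)
    (ht : t ∈ Icc 0 T) (a b : X) : 0 ≤ transitionCost F lam t a b := by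
  refine Real.sInf_nonneg ?_
  rintro _ ⟨N, w, -, -, -, rfl⟩
  exact add_nonneg (Finset.sum_nonneg fun i _ => by positivity)
    (Finset.sum_nonneg fun i _ => residual_nonneg hF hT hlam ht _)

namespace IsSchemeLimit

variable {u uₗ uᵣ : ℝ → X} {W : ℝ → ℝ} [FiniteDimensional ℝ X]

theorem isStable_regulated_right (h : IsSchemeLimit T F u₀ lam σ τ U u W)
    (hu : IsRegulatedWith T u uₗ uᵣ) (ht : t ∈ Icc 0 T) : IsStable F lam t (uᵣ t) := by
  rcases ht.2.eq_or_lt with rfl | hlt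
  · rw [hu.right_end]
    have ht' : t ∈ Ioc 0 t := ⟨h.family.T_pos, le_rfl⟩
    exact h.isStable_left ht' (hu.left t ht')
  · exact h.isStable_right ⟨ht.1, hlt⟩ (hu.right t ⟨ht.1, hlt⟩)

/-- Identifies the one-sided limits of W: their difference at an interior time is the energy gap
between the left and right limits of `u`. -/
theorem tendsto_cost_of_tendsto (h : IsSchemeLimit T F u₀ lam σ τ U u W) (ht : t ∈ Icc 0 T)
    {l : Filter ℝ} {p : X} (hl : l ≤ 𝓝[Icc 0 T] t) (hp : Tendsto u l (𝓝 p)) :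
    Tendsto W l (𝓝 (F 0 u₀ - F t p + ∫ r in (0 : ℝ)..t, timeDeriv T F r (u r))) := by
  have h0 : (0 : ℝ) ∈ Icc 0 T := left_mem_Icc.2 h.family.T_pos.le
  have hmem : ∀ᶠ r in l, r ∈ Icc 0 T := hl self_mem_nhdsWithin
  have hF : Tendsto (fun r => F r (u r)) l (𝓝 (F t p)) :=
    (h.family.energy.continuousOn (t, p) ⟨ht, mem_univ _⟩).tendsto.comp
      (tendsto_nhdsWithin_iff.2 ⟨(tendsto_id'.2 (hl.trans nhdsWithin_le_nhds)).prodMk_nhds hp,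
        hmem.mono fun r hr => ⟨hr, mem_univ _⟩⟩)
  have hint : Tendsto (fun s => ∫ r in (0 : ℝ)..s, timeDeriv T F r (u r)) l
      (𝓝 (∫ r in (0 : ℝ)..t, timeDeriv T F r (u r))) := by
    have hi : MeasureTheory.IntegrableOn (fun r => timeDeriv T F r (u r)) (uIcc 0 T) := by
      rw [uIcc_of_le h.family.T_pos.le, ← intervalIntegrable_iff_integrableOn_Icc_of_le
        h.family.T_pos.le]
      exact h.intervalIntegrable h0 (right_mem_Icc.2 h.family.T_pos.le)
    have hc := intervalIntegral.continuousOn_primitive_interval hi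
    rw [uIcc_of_le h.family.T_pos.le] at hc
    exact (hc t ht).tendsto.mono_left hl
  refine ((hF.const_sub _).add hint).congr' ?_
  filter_upwards [hmem] with r hr
  exact (h.cost_eq hr).symm

theorem tendsto_cost_left (h : IsSchemeLimit T F u₀ lam σ τ U u W)
    (hu : IsRegulatedWith T u uₗ uᵣ) (ht : t ∈ Ioc 0 T) :
    Tendsto W (𝓝[<] t)
      (𝓝 (F 0 u₀ - F t (uₗ t) + ∫ r in (0 : ℝ)..t, timeDeriv T F r (u r))) := by
  refine h.tendsto_cost_of_tendsto ⟨ht.1.le, ht.2⟩ ?_ (hu.left t ht)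
  rw [← nhdsWithin_Ico_eq_nhdsLT ht.1]
  exact nhdsWithin_mono _ fun r hr => ⟨hr.1, hr.2.le.trans ht.2⟩

theorem tendsto_cost_right (h : IsSchemeLimit T F u₀ lam σ τ U u W)
    (hu : IsRegulatedWith T u uₗ uᵣ) (ht : t ∈ Ico 0 T) :
    Tendsto W (𝓝[>] t)
      (𝓝 (F 0 u₀ - F t (uᵣ t) + ∫ r in (0 : ℝ)..t, timeDeriv T F r (u r))) := by
  refine h.tendsto_cost_of_tendsto ⟨ht.1, ht.2.le⟩ ?_ (hu.right t ht)
  rw [← nhdsWithin_Ioc_eq_nhdsGT ht.2]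
  exact nhdsWithin_mono _ fun r hr => ⟨ht.1.trans hr.1.le, hr.2⟩

/-- The reduced energy of the right limits has nonnegative lower right Dini derivatives. -/
theorem eventually_reducedEnergy_ge (h : IsSchemeLimit T F u₀ lam σ τ U u W)
    (hu : IsRegulatedWith T u uₗ uᵣ) (ht : t ∈ Ico 0 T) {e : ℝ} (he : 0 < e) :
    ∀ᶠ y in 𝓝[>] t, F t (uᵣ t) - e * (y - t) ≤
      F y (uᵣ y) - ∫ r in t..y, timeDeriv T F r (u r) := by
  have hF := h.family.energy
  have hT := h.family.T_pos
  have htI : t ∈ Icc 0 T := ⟨ht.1, ht.2.le⟩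
  set p := uᵣ t with hp
  have hcrit := (h.isStable_regulated_right hu htI).mem_criticalSet hF htI
  obtain ⟨L, V, hV, hLip⟩ := hF.F5 p
  -- Half of e pays for the gradient term, half for the integral; L + 1 avoids dividing by zero.
  have hF4 := eventually_energy_ge hF htI hcrit (show 0 < e / (2 * (L + 1)) by positivity)
  have hG := (hF.continuousOn_timeDeriv hT (t, p) ⟨htI, mem_univ _⟩).eventually
    (Metric.ball_mem_nhds (timeDeriv T F t p) (show 0 < e / 4 by positivity))
  obtain ⟨ρ₁, hρ₁, hG⟩ := Metric.mem_nhdsWithin_iff.1 hG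
  obtain ⟨ρ₂, hρ₂, hF4⟩ := Metric.mem_nhds_iff.1 (inter_mem hF4 hV)
  have hρ : 0 < min ρ₁ ρ₂ := lt_min hρ₁ hρ₂
  obtain ⟨b, hb, hball⟩ := (mem_nhdsGT_iff_exists_Ioo_subset).1
    (inter_mem ((hu.right t ht).eventually (Metric.closedBall_mem_nhds p (half_pos hρ)))
      (Ioo_mem_nhdsGT (lt_min ht.2 (lt_add_of_pos_right t hρ₁))))
  filter_upwards [Ioo_mem_nhdsGT hb] with y hy
  have hub : ∀ r ∈ Ioo t b, dist (u r) p < min ρ₁ ρ₂ := fun r hr =>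
    lt_of_le_of_lt (hball hr).1 (half_lt_self hρ)
  have htime : ∀ r ∈ Ioo t b, r < T ∧ r < t + ρ₁ := fun r hr => lt_min_iff.1 (hball hr).2.2
  have hyI : y ∈ Ico 0 T := ⟨ht.1.trans hy.1.le, (htime y hy).1⟩
  have hyI' : y ∈ Icc 0 T := ⟨hyI.1, hyI.2.le⟩
  set q := uᵣ y with hq
  have hqp : dist q p < min ρ₁ ρ₂ := by
    refine lt_of_le_of_lt (le_of_tendsto ((hu.right y hyI).dist tendsto_const_nhds) ?_)
      (half_lt_self hρ)
    filter_upwards [Ioo_mem_nhdsGT hy.2] with r hr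
    exact (hball ⟨hy.1.trans hr.1, hr.2⟩).1
  have hqV := hF4 (Metric.mem_ball.2 (hqp.trans_le (min_le_right _ _)))
  have hcritq : gradient (F y) q = 0 :=
    (h.isStable_regulated_right hu hyI').mem_criticalSet hF hyI'
  -- The point `q` is critical at time y, and (F5) transfers this to time t with an error linear in
  -- y - t.
  have hgrad : ‖gradient (F t) q‖ ≤ L * (y - t) := by
    have := (hLip q hqV.2).dist_le_mul t htI y hyI'
    rw [hcritq, dist_zero_right, dist_comm, Real.dist_eq, abs_of_pos (sub_pos.2 hy.1)] at this
    exact this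
  have h1 : e / (2 * (L + 1)) * ‖gradient (F t) q‖ ≤ e / 2 * (y - t) := by
    have hyt := sub_pos.2 hy.1
    have hL : (0 : ℝ) ≤ L := L.2
    calc e / (2 * (L + 1)) * ‖gradient (F t) q‖
        ≤ e / (2 * (L + 1)) * ((L + 1) * (y - t)) := by
          refine mul_le_mul_of_nonneg_left (hgrad.trans ?_) (by positivity)
          nlinarith
      _ = e / 2 * (y - t) := by field_simp
  have h2 : F t p - e / (2 * (L + 1)) * ‖gradient (F t) q‖ ≤ F t q := hqV.1
  have h3 := hF.integral_timeDeriv hT htI hyI' hy.1.le q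
  -- Both `q` and `u r` are near `p`, so the two powers differ by less than e/2.
  have h4 : |(∫ r in t..y, timeDeriv T F r q) - ∫ r in t..y, timeDeriv T F r (u r)| ≤
      e / 2 * (y - t) := by
    rw [← intervalIntegral.integral_sub (hF.intervalIntegrable_timeDeriv hT htI hyI' q)
      (h.intervalIntegrable htI hyI')]
    rw [← abs_of_pos (sub_pos.2 hy.1)]
    change ‖∫ r in t..y, (timeDeriv T F r q - timeDeriv T F r (u r))‖ ≤ _
    refine intervalIntegral.norm_integral_le_of_norm_le_const fun r hr => ?_
    rw [uIoc_of_le hy.1.le] at hr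
    have hrb : r ∈ Ioo t b := ⟨hr.1, hr.2.trans_lt hy.2⟩
    have hG' : ∀ v, dist v p < min ρ₁ ρ₂ →
        dist (timeDeriv T F r v) (timeDeriv T F t p) < e / 4 := fun v hv => by
      refine hG (show (r, v) ∈ _ from ⟨?_, ⟨ht.1.trans hr.1.le, (htime r hrb).1.le⟩, mem_univ _⟩)
      rw [Metric.mem_ball, Prod.dist_eq, max_lt_iff]
      refine ⟨?_, hv.trans_le (min_le_left _ _)⟩
      rw [Real.dist_eq, abs_of_pos (sub_pos.2 hr.1)]
      linarith [(htime r hrb).2]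
    rw [← dist_eq_norm]
    have := dist_triangle_right (timeDeriv T F r q) (timeDeriv T F r (u r)) (timeDeriv T F t p)
    linarith [hG' q hqp, hG' (u r) (hub r hrb)]
  have h5 := (abs_le.1 h4).1
  linarith

/-- The energy balance, for right limits that may be modified at the final time. -/
theorem energyBalance_of_stable (h : IsSchemeLimit T F u₀ lam σ τ U u W)
    (hu : IsRegulatedWith T u uₗ uᵣ) {v : X} (hv : IsStable F lam T v) (hv' : v = u T ∨ v = uᵣ T)
    {s t : ℝ} (hs : 0 ≤ s) (hst : s ≤ t) (ht : t ≤ T) :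
    EnergyBalance T F lam u uₗ (Function.update uᵣ T v) s t := by
  have hF := h.family.energy
  have hT := h.family.T_pos
  have hlam := h.family.lam_pos
  set w := Function.update uᵣ T v with hw
  have hwT : w T = v := Function.update_self _ _ _
  have hwt : ∀ r, r ≠ T → w r = uᵣ r := fun r hr => Function.update_of_ne hr _ _
  set P : ℝ → ℝ := fun x => ∫ r in (0 : ℝ)..x, timeDeriv T F r (u r) with hP
  have h0I : (0 : ℝ) ∈ Icc 0 T := left_mem_Icc.2 hT.le
  have hTI : T ∈ Icc 0 T := right_mem_Icc.2 hT.le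
  have hPsub : ∀ x ∈ Icc 0 T, ∀ y ∈ Icc 0 T,
      ∫ r in x..y, timeDeriv T F r (u r) = P y - P x := fun x hx y hy => by
    have := intervalIntegral.integral_add_adjacent_intervals (h.intervalIntegrable h0I hx)
      (h.intervalIntegrable hx hy)
    simp only [hP]
    linarith
  -- Reduced energies: where they make sense, the left and right limits of W are F(0,u₀) - Em and
  -- F(0,u₀) - Ep, except that at T a modified `v` makes Ep correspond to W(T).
  set Em : ℝ → ℝ := fun x => F x (uₗ x) - P x with hEm
  set Ep : ℝ → ℝ := fun x => F x (w x) - P x with hEp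
  have hWl : ∀ x ∈ Ioc 0 T, Tendsto W (𝓝[<] x) (𝓝 (F 0 u₀ - Em x)) := fun x hx => by
    have := h.tendsto_cost_left hu hx
    rwa [← sub_add]
  have hWr : ∀ x ∈ Ico 0 T, Tendsto W (𝓝[>] x) (𝓝 (F 0 u₀ - Ep x)) := fun x hx => by
    have := h.tendsto_cost_right hu hx
    simp only [hEp]
    rwa [← sub_add, hwt x hx.2.ne]
  have hWle : ∀ x ∈ Ico 0 T, W x ≤ F 0 u₀ - Ep x := fun x hx =>
    ge_of_tendsto (hWr x hx) (eventually_nhdsWithin_of_forall fun y hy => h.monotone (le_of_lt hy))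
  have hWge : ∀ x ∈ Ioc 0 T, F 0 u₀ - Em x ≤ W x := fun x hx =>
    le_of_tendsto (hWl x hx) (eventually_nhdsWithin_of_forall fun y hy => h.monotone (le_of_lt hy))
  have hstab : ∀ x ∈ Icc 0 T, IsStable F lam x (w x) := fun x hx => by
    rcases eq_or_ne x T with rfl | hne
    · rwa [hwT]
    · rw [hwt x hne]; exact h.isStable_regulated_right hu hx
  have hjump : ∀ x ∈ Icc 0 T, uₗ x ≠ w x → transitionCost F lam x (w x) (uₗ x) = Em x - Ep x := by
    intro x hx hne
    refine le_antisymm ?_ ?_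
    · have key : transitionCost F lam x (w x) (uₗ x) ≤ (F 0 u₀ - Ep x) - (F 0 u₀ - Em x) := by
        refine h.transitionCost_le hx hne (hstab x hx) (fun e he => ?_) (fun e he => ?_)
        · rcases hx.1.eq_or_lt with rfl | hpos
          -- At time 0 the left value is u₀ itself, possibly unstable, from which every scheme
          -- starts exactly.
          · refine ⟨0, hx, le_rfl, by simpa using he, ?_, Or.inr fun j => ?_⟩
            · simp [hEm, hP, hu.left_zero, h.apply_zero, h.cost_zero, he]
            · rw [schemeIndex_zero, h.family.start, hu.left_zero, h.apply_zero]
          · have hx' : x ∈ Ioc 0 T := ⟨hpos, hx.2⟩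
            obtain ⟨y, ⟨hy1, hy2⟩, hy3⟩ := (((hWl x hx').eventually
              (lt_mem_nhds (sub_lt_self (F 0 u₀ - Em x) he))).and
                ((hu.left x hx').eventually (Metric.ball_mem_nhds _ he))).and
                  (Ioo_mem_nhdsLT (max_lt hpos (sub_lt_self x he))) |>.exists
            have hy4 := max_lt_iff.1 hy3.1
            exact ⟨y, ⟨hy4.1.le, hy3.2.le.trans hx.2⟩, hy3.2.le, by linarith [hy4.2], hy1,
              Or.inl ⟨hy2, h.isStable_left hx' (hu.left x hx')⟩⟩
        · rcases hx.2.eq_or_lt with rfl | hlt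
          -- At T with `v = u T`, the value W(T) takes the place of the missing right limit; with `v
          -- = uᵣ T` there is no jump.
          · rcases hv' with rfl | rfl
            · refine ⟨x, hx, le_rfl, by simpa using he, ?_, by simpa [hwT] using he⟩
              rw [h.cost_eq hx]
              simp only [hEp, hwT, hP]
              linarith
            · exact absurd (by rw [hwT, hu.right_end]) hne
          · have hx' : x ∈ Ico 0 T := ⟨hx.1, hlt⟩
            have hr := hu.right x hx'
            rw [← hwt x hlt.ne] at hr
            obtain ⟨z, ⟨hz1, hz2⟩, hz3⟩ := (((hWr x hx').eventually
              (gt_mem_nhds (lt_add_of_pos_right (F 0 u₀ - Ep x) he))).and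
                (hr.eventually (Metric.ball_mem_nhds _ he))).and
                  (Ioo_mem_nhdsGT (lt_min hlt (lt_add_of_pos_right x he))) |>.exists
            have hz4 := lt_min_iff.1 hz3.2
            exact ⟨z, ⟨hx.1.trans hz3.1.le, hz4.1.le⟩, hz3.1.le, by linarith [hz4.2], hz1, hz2⟩
      linarith
    · have := sub_le_transitionCost hF hT hlam hx (w x) (uₗ x)
      simp only [hEm, hEp]
      linarith
  have hI : ∀ x ∈ Icc s t, x ∈ Icc 0 T := fun x hx => ⟨hs.trans hx.1, hx.2.trans ht⟩
  have hgap : ∀ x ∈ Icc s t, Ep x ≤ Em x := by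
    intro x hx
    by_cases hne : uₗ x = w x
    · simp only [hEm, hEp, hne, le_refl]
    · have := transitionCost_nonneg hF hT hlam (hI x hx) (w x) (uₗ x)
      rw [hjump x (hI x hx) hne] at this
      linarith
  have hsum := hasSum_gap (Em := Em) (Ep := Ep) hst hgap
    (fun x hx y hy hxy => by
      have h1 := hWle x ⟨(hI x hx).1, hxy.trans_le (hI y hy).2⟩
      have hy' : y ∈ Ioc 0 T := ⟨(hI x hx).1.trans_lt hxy, (hI y hy).2⟩
      have h2 : F 0 u₀ - Ep x ≤ F 0 u₀ - Em y := by
        refine le_of_tendsto_of_tendsto (hWr x ⟨(hI x hx).1, hxy.trans_le (hI y hy).2⟩)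
          (tendsto_const_nhds (x := F 0 u₀ - Em y)) ?_
        filter_upwards [Ioo_mem_nhdsGT hxy] with z hz
        refine ge_of_tendsto (hWl y hy') ?_
        filter_upwards [Ioo_mem_nhdsLT hz.2] with z' hz' using h.monotone hz'.1.le
      linarith)
    (fun x hx e he => by
      have hx' : x ∈ Ioc 0 T := ⟨hs.trans_lt hx.1, hx.2.trans ht⟩
      filter_upwards [(hWl x hx').eventually (lt_mem_nhds (sub_lt_self (F 0 u₀ - Em x) he)),
        Ioo_mem_nhdsLT hx'.1] with y hy1 hy2
      linarith [hWle y ⟨hy2.1.le, hy2.2.trans_le hx'.2⟩])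
    (fun x hx e he => by
      have hx' : x ∈ Ico 0 T := ⟨hs.trans hx.1, hx.2.trans_le ht⟩
      filter_upwards [h.eventually_reducedEnergy_ge hu hx' he, Ioo_mem_nhdsGT hx'.2] with y hy1 hy2
      have hyI : y ∈ Icc 0 T := ⟨hx'.1.trans hy2.1.le, hy2.2.le⟩
      rw [hPsub x ⟨hx'.1, hx'.2.le⟩ y hyI] at hy1
      simp only [hEp, hwt x hx'.2.ne, hwt y hy2.2.ne]
      linarith)
  refine ⟨h.intervalIntegrable (hI s (left_mem_Icc.2 hst)) (hI t (right_mem_Icc.2 hst)),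
    Em s - Ep t, ?_, ?_⟩
  -- The gap vanishes off the jump set, so the sum over jumps is the sum of all gaps.
  · refine (hasSum_subtype_iff_indicator
      (f := fun r => transitionCost F lam r (w r) (uₗ r))).2 ?_
    convert hsum using 1
    ext r
    by_cases hr : r ∈ Icc s t
    · by_cases hne : uₗ r = w r
      · rw [indicator_of_mem hr, indicator_of_notMem fun hm => hm.1.2 hne]
        simp only [hEm, hEp, hne, sub_self]
      · have hm : r ∈ jumpSet T uₗ w ∩ Icc s t := ⟨⟨hI r hr, hne⟩, hr⟩
        rw [indicator_of_mem hr, indicator_of_mem hm, hjump r (hI r hr) hne]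
    · rw [indicator_of_notMem hr, indicator_of_notMem fun hm => hr hm.2]
  · rw [hPsub s (hI s (left_mem_Icc.2 hst)) t (hI t (right_mem_Icc.2 hst))]
    simp only [hEm, hEp]
    ring

theorem energyBalance (h : IsSchemeLimit T F u₀ lam σ τ U u W)
    (hu : IsRegulatedWith T u uₗ uᵣ) {s t : ℝ} (hs : 0 ≤ s) (hst : s ≤ t) (ht : t ≤ T) :
    EnergyBalance T F lam u uₗ uᵣ s t := by
  have := h.energyBalance_of_stable hu
    (h.isStable_regulated_right hu (right_mem_Icc.2 h.family.T_pos.le)) (Or.inr rfl) hs hst ht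
  rwa [Function.update_eq_self] at this

end IsSchemeLimit

theorem IsDiscreteSolution.isSchemeFamily (hT : 0 < T) (hF : EnergyAssumptions T F)
    (hlam : 0 < lam) {ε τ : ℕ → ℝ} (hε : ∀ j, 0 < ε j) (hτ : ∀ j, 0 < τ j)
    (hτ0 : Tendsto τ atTop (𝓝 0)) (hratio : Tendsto (fun j => ε j / τ j) atTop (𝓝 lam))
    (hU : ∀ j, IsDiscreteSolution T F u₀ (ε j) (τ j) (U j)) :
    IsSchemeFamily T F u₀ lam (fun j => ε j / τ j) τ U where
  energy := hF
  T_pos := hT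
  lam_pos := hlam
  σ_pos j := div_pos (hε j) (hτ j)
  τ_pos := hτ
  σ_tendsto := hratio
  τ_tendsto := hτ0
  start j := (hU j).1
  step j k hk v := by
    have := (hU j).2 (k + 1) (Nat.le_add_left 1 k) hk (mem_univ v)
    rw [Nat.add_sub_cancel] at this
    rw [show ε j / τ j / 2 = ε j / (2 * τ j) by rw [div_div, mul_comm]]
    exact this

end MinMov

theorem mainTheorem2 {X : Type*} [NormedAddCommGroup X] [InnerProductSpace ℝ X]
    [CompleteSpace X] [FiniteDimensional ℝ X]
    (T : ℝ) (hT : 0 < T) (F : ℝ → X → ℝ) (hF : MinMov.EnergyAssumptions T F)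
    (u₀ : X) (lam : ℝ) (hlam : 0 < lam)
    (ε τ : ℕ → ℝ) (hε : ∀ j, 0 < ε j) (hτ : ∀ j, 0 < τ j)
    (hε0 : Tendsto ε atTop (𝓝 0)) (hτ0 : Tendsto τ atTop (𝓝 0))
    (hratio : Tendsto (fun j => ε j / τ j) atTop (𝓝 lam))
    (U : ℕ → ℕ → X) (hU : ∀ j, MinMov.IsDiscreteSolution T F u₀ (ε j) (τ j) (U j)) :
    ∃ φ : ℕ → ℕ, StrictMono φ ∧ ∃ u uₗ uᵣ : ℝ → X,
      -- pointwise convergence of the interpolants along the subsequence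
      (∀ t ∈ Icc (0 : ℝ) T,
        Tendsto (fun j => MinMov.interpolant T (τ (φ j)) (U (φ j)) t) atTop (𝓝 (u t))) ∧
      -- the limit is regulated
      MinMov.IsRegulatedWith T u uₗ uᵣ ∧
      -- stability
      (∀ t ∈ Icc (0 : ℝ) T, MinMov.IsStable F lam t (uᵣ t)) ∧
      (∀ t ∈ Ioc (0 : ℝ) T, MinMov.IsStable F lam t (uₗ t)) ∧
      -- energy balance
      (∀ s t : ℝ, 0 ≤ s → s ≤ t → t ≤ T → MinMov.EnergyBalance T F lam u uₗ uᵣ s t) ∧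
      -- energy balance up to the final time with `u(T)` as right limit at `T`, if `u(T)` is stable
      (MinMov.IsStable F lam T (u T) → ∀ s ∈ Icc (0 : ℝ) T,
        MinMov.EnergyBalance T F lam u uₗ (Function.update uᵣ T (u T)) s T) := by
  obtain ⟨φ, hφ, u, W, h⟩ := (MinMov.IsDiscreteSolution.isSchemeFamily hT hF hlam hε hτ hτ0 hratio
    hU).exists_limit
  obtain ⟨uₗ, uᵣ, hu⟩ := h.exists_isRegulatedWith
  exact ⟨φ, hφ, u, uₗ, uᵣ, fun t _ => h.tendsto t, hu,
    fun t ht => h.isStable_regulated_right hu ht,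
    fun t ht => h.isStable_left ht (hu.left t ht),
    fun s t hs hst ht => h.energyBalance hu hs hst ht,
    fun hstab s hs => h.energyBalance_of_stable hu hstab (Or.inl rfl) hs.1 hs.2 le_rfl⟩
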